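/- **Definitions.** A word $u$ is a *factor* of a word $w$ if $w = xuy$ for some (possibly empty) words $x, y$. For a sequence $(s_k)_{k\ge 1}$ of positive integers define binary words by $\alpha_1 = 01$ and $\alpha_{i+1} = (\alpha_i)^{s_i}(\overline{\alpha_i})^{s_i}$ for $i \ge 1$, where $\overline{\alpha}$ is obtained from $\alpha$ by exchanging the letters $0$ and $1$ and powers denote repeated concatenation. Let $\mathcal{L}^{(s_k)}$ be the set of all factors of the words $\alpha_i$, $i \ge 1$. Let $\rho$ be the substitution $0 \mapsto \mathsf{d}\,\mathsf{r_d}$, $1 \mapsto \mathsf{u}\,\mathsf{r_u}$, and let $\mathcal{P}^{(s_k)}$ be the set of all factors of the words $\rho(w)$, $w \in \mathcal{L}^{(s_k)}$. For a word $w = w_1 \cdots w_n$ whose letters alternate between $\{\mathsf{u}, \mathsf{d}\}$ and $\{\mathsf{r_u}, \mathsf{r_d}\}$, place points $p_0, p_1, \dots, p_n$ in the plane as follows. The point $p_0$ (the origin) is arbitrary. The point $p_1$ lies above and to the right of $p_0$ if $w_1 \in \{\mathsf{u}, \mathsf{r_u}\}$, and below and to the right of $p_0$ if $w_1 \in \{\mathsf{d},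 \mathsf{r_d}\}$. For $i \ge 2$, the point $p_i$ lies above (if $w_i = \mathsf{u}$), below (if $w_i = \mathsf{d}$), or to the right of (if $w_i \in \{\mathsf{r_u}, \mathsf{r_d}\}$) the rectangular hull of $p_0, \dots, p_{i-1}$, and it separates $p_{i-1}$ from $p_0, \dots, p_{i-2}$: horizontally if $w_i \in \{\mathsf{u}, \mathsf{d}\}$ (its $x$-coordinate lies strictly between that of $p_{i-1}$ and those of $p_0, \dots, p_{i-2}$), and vertically (the same with $y$-coordinates) if $w_i \in \{\mathsf{r_u}, \mathsf{r_d}\}$. This determines the relative order of the coordinates of $p_0, \dots, p_n$. Let $\psi_w^\circ$ be the permutation of length $n$ order isomorphic to $\{p_1, \dots, p_n\}$ (the origin is omitted). Let $\mathcal{C}^{(s_k)}$ be the set of all permutations contained, as patterns, in some $\psi_w^\circ$ with $w \in \mathcal{P}^{(s_k)}$, and let $\mathcal{C}^{(s_k)}_n$ be the set of its members of length $n$. Its *enumeration sequence* is $\bigl(|\mathcal{C}^{(s_k)}_n|\bigr)_{n \ge 0}$. **Theorem.** Let $(s_k)$ and $(t_k)$ be distinct sequences of positive integers such that $(s_k)$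 lexicographically precedes $(t_k)$; that is, there is an index $I$ with $s_i = t_i$ for all $i < I$ and $s_I < t_I$. Then there exists an integer $N$ such that $$\bigcup_{n \le N} \mathcal{C}^{(t_k)}_n \subsetneq \bigcup_{n \le N} \mathcal{C}^{(s_k)}_n .$$ In particular, the classes $\mathcal{C}^{(s_k)}$ and $\mathcal{C}^{(t_k)}$ have distinct enumeration sequences. -/

import Mathlib

/-! ### Words -/

/-- The factor closure of a set of words: all consecutive subwords (`u <:+: w`) of its members. -/
def factorClosure {A : Type*} (S : Set (List A)) : Set (List A) :=
  {u | ∃ w ∈ S, u <:+: w}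

/-- The complement of a binary word (`false` is the letter `0`, `true` is the letter `1`). -/
def complementWord (w : List Bool) : List Bool := w.map Bool.not

/-- The concatenation of `k` copies of the word `w`. -/
def wordPow {A : Type*} (w : List A) (k : ℕ) : List A := (List.replicate k w).flatten

/-- The words `α_1, α_2, …` attached to a sequence `s_1, s_2, …`, with all indices shifted to
start at `0`: the value at `i` is `α_{i+1}`, and `s i` is `s_{i+1}`. -/
def alphaWord (s : ℕ → ℕ) : ℕ → List Bool
  | 0 => [false, true]
  | i + 1 => wordPow (alphaWord s i) (s i) ++ wordPow (complementWord (alphaWord s i)) (s i)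

/-- The binary language of all factors of the words `α_i`. -/
def pouzetLanguage (s : ℕ → ℕ) : Set (List Bool) :=
  factorClosure (Set.range (alphaWord s))

/-! ### Pin words -/

/-- The alphabet `u`, `d`, `r_u`, `r_d`. -/
inductive PinLetter : Type where
  | u : PinLetter
  | d : PinLetter
  | ru : PinLetter
  | rd : PinLetter

namespace PinLetter

/-- Whether the letter is one of the right letters `r_u`, `r_d`. -/
def isRight : PinLetter → Bool
  | u => false
  | d => false
  | ru => true
  | rd => true

/-- `1` for the letters `u`, `r_u` and `-1` for the letters `d`, `r_d`. -/
def sign : PinLetter → ℤ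
  | u => 1
  | d => -1
  | ru => 1
  | rd => -1

end PinLetter

/-- The substitution `0 ↦ d r_d`, `1 ↦ u r_u`. -/
def rho (w : List Bool) : List PinLetter :=
  w.flatMap fun b => if b then [PinLetter.u, PinLetter.ru] else [PinLetter.d, PinLetter.rd]

/-- The factor closure of the image under `rho` of the language attached to `s`. -/
def pinLanguage (s : ℕ → ℕ) : Set (List PinLetter) :=
  factorClosure (rho '' pouzetLanguage s)

/-- Words in which the letters alternate between `{u, d}` and `{r_u, r_d}`. -/
def Alternating (w : List PinLetter) : Prop :=
  ∀ (i : ℕ) (h : i + 1 < w.length), w[i].isRight ≠ w[i + 1].isRight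

/-! ### Pin sequences, geometrically

Only the relative order of the coordinates matters, so the coordinates may be taken in any linear
order (for instance `ℝ` or `ℤ`). -/

section Geometry

variable {K : Type*} [LinearOrder K]

/-- The point `q` lies horizontally between `p i` and the rectangular hull of
`p 0, …, p (i - 1)`. -/
def SeparatesH (p : ℕ → K × K) (i : ℕ) (q : K × K) : Prop :=
  ((∀ j < i, (p j).1 < q.1) ∧ q.1 < (p i).1) ∨ ((p i).1 < q.1 ∧ ∀ j < i, q.1 < (p j).1)

/-- The point `q` lies vertically between `p i` and the rectangular hull of
`p 0, …, p (i - 1)`. -/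
def SeparatesV (p : ℕ → K × K) (i : ℕ) (q : K × K) : Prop :=
  ((∀ j < i, (p j).2 < q.2) ∧ q.2 < (p i).2) ∨ ((p i).2 < q.2 ∧ ∀ j < i, q.2 < (p j).2)

/-- The position of the first pin `q` relative to the origin `o`, by the letter encoding it. -/
def IsFirstPin (o q : K × K) : PinLetter → Prop
  | .u => o.1 < q.1 ∧ o.2 < q.2
  | .ru => o.1 < q.1 ∧ o.2 < q.2
  | .d => o.1 < q.1 ∧ q.2 < o.2
  | .rd => o.1 < q.1 ∧ q.2 < o.2

/-- The point `q` is a proper pin for the sequence `p 0, …, p i` in the direction given by a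
letter: it lies on that side of the rectangular hull of `p 0, …, p i`, and it separates `p i` from
`p 0, …, p (i - 1)`. The subscript of a right letter plays no role here. -/
def IsProperPin (p : ℕ → K × K) (i : ℕ) (q : K × K) : PinLetter → Prop
  | .u => (∀ j ≤ i, (p j).2 < q.2) ∧ SeparatesH p i q
  | .d => (∀ j ≤ i, q.2 < (p j).2) ∧ SeparatesH p i q
  | .ru => (∀ j ≤ i, (p j).1 < q.1) ∧ SeparatesV p i q
  | .rd => (∀ j ≤ i, (p j).1 < q.1) ∧ SeparatesV p i q

/-- `p 0, p 1, …, p n` are the origin and the pins of a rightward-yearning pin sequence defined by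
the word `w` of length `n`; the letter `w[i]` encodes the pin `p (i + 1)`. -/
def IsPinSequence (w : List PinLetter) (p : ℕ → K × K) : Prop :=
  (∀ h : 0 < w.length, IsFirstPin (p 0) (p 1) w[0]) ∧
  ∀ (i : ℕ) (h : i + 1 < w.length), IsProperPin p (i + 1) (p (i + 2)) w[i + 1]

/-- The permutation `π` (of positions and values `0, …, n - 1`) is order isomorphic to the family
`q` of points: `e` lists the points from left to right. -/
def IsOrderIsoTo {n : ℕ} (π : Equiv.Perm (Fin n)) (q : Fin n → K × K) : Prop :=
  ∃ e : Equiv.Perm (Fin n), StrictMono (fun a => (q (e a)).1) ∧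
    ∀ a b, π a < π b ↔ (q (e a)).2 < (q (e b)).2

/-- The permutation order isomorphic to a family of points without a common coordinate. -/
def orderPerm {n : ℕ} (q : Fin n → K × K) : Equiv.Perm (Fin n) :=
  (Tuple.sort fun i => (q i).1).trans (Tuple.sort fun i => (q i).2).symm

end Geometry

/-! ### The permutation of a pin word -/

/-- A concrete pin sequence for the word `w`, on the integer grid, with origin `(0, 0)`. -/
def pinPoint (w : List PinLetter) : ℕ → ℤ × ℤ
  | 0 => (0, 0)
  | 1 => (2, 2 * (w.getD 0 .u).sign)
  | k + 2 =>
      if (w.getD (k + 1) .u).isRight then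
        (2 * (k : ℤ) + 4, (2 * (k : ℤ) + 1) * (w.getD k .u).sign)
      else (2 * (k : ℤ) + 1, (2 * (k : ℤ) + 4) * (w.getD (k + 1) .u).sign)

/-- The permutation `ψ°_w` order isomorphic to the pins `p_1, …, p_n` (without the origin) of the
pin sequence defined by the word `w`. See `pinPoint_isPinSequence` and `pinPerm_isOrderIsoTo`. -/
def pinPerm (w : List PinLetter) : Equiv.Perm (Fin w.length) :=
  orderPerm fun k : Fin w.length => pinPoint w ((k : ℕ) + 1)

section PinFacts

variable {K : Type*} [LinearOrder K]

theorem orderPerm_isOrderIsoTo {n : ℕ} {q : Fin n → K × K}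
    (h1 : Function.Injective fun i => (q i).1) (h2 : Function.Injective fun i => (q i).2) :
    IsOrderIsoTo (orderPerm q) q := by
  refine ⟨Tuple.sort fun i => (q i).1, ?_, ?_⟩
  · exact (Tuple.monotone_sort fun i => (q i).1).strictMono_of_injective
      (h1.comp (Equiv.injective _))
  · intro a b
    have hm : StrictMono ((fun i => (q i).2) ∘ Tuple.sort fun i => (q i).2) :=
      (Tuple.monotone_sort fun i => (q i).2).strictMono_of_injective
        (h2.comp (Equiv.injective _))
    rw [← hm.lt_iff_lt]
    simp [orderPerm]

/-- The direction of a pin relative to the origin. -/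
theorem IsPinSequence.origin_lt {w : List PinLetter} {p : ℕ → K × K} (hp : IsPinSequence w p)
    {k : ℕ} (hk : k < w.length) :
    (w[k].isRight = true → (p 0).1 < (p (k + 1)).1) ∧
    (w[k] = .u → (p 0).2 < (p (k + 1)).2) ∧ (w[k] = .d → (p (k + 1)).2 < (p 0).2) := by
  rcases k with _ | k
  · have h := hp.1 hk
    generalize w[0] = c at h ⊢
    cases c <;> simp_all [IsFirstPin, PinLetter.isRight]
  · have h := hp.2 k hk
    generalize w[k + 1] = c at h ⊢
    cases c <;> simp_all [IsProperPin, PinLetter.isRight]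

/-- Two pin sequences of the same alternating word have the same order of coordinates. -/
theorem IsPinSequence.same_order {L : Type*} [LinearOrder L] {w : List PinLetter}
    (hw : Alternating w) {p : ℕ → K × K} {q : ℕ → L × L} (hp : IsPinSequence w p)
    (hq : IsPinSequence w q) {i j : ℕ} (hij : i < j) (hj : j ≤ w.length) :
    (((p i).1 < (p j).1 ∧ (q i).1 < (q j).1) ∨ ((p j).1 < (p i).1 ∧ (q j).1 < (q i).1)) ∧
    (((p i).2 < (p j).2 ∧ (q i).2 < (q j).2) ∨ ((p j).2 < (p i).2 ∧ (q j).2 < (q i).2)) := by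
  rcases j with _ | _ | k
  · omega
  · obtain rfl : i = 0 := by omega
    have h := hp.1 hj
    have h' := hq.1 hj
    generalize w[0] = c at h h'
    cases c <;> simp_all [IsFirstPin]
  · have h := hp.2 k (by omega)
    have h' := hq.2 k (by omega)
    have o := hp.origin_lt (k := k) (by omega)
    have o' := hq.origin_lt (k := k) (by omega)
    have alt := hw k (by omega)
    have hi : i ≤ k + 1 := by omega
    have hsplit : i = k + 1 ∨ i < k + 1 := by omega
    generalize w[k + 1] = c at h h' alt
    generalize w[k] = b at o o' alt
    cases c <;> cases b <;>
      simp only [PinLetter.isRight, ne_eq, not_true_eq_false, reduceCtorEq, IsProperPin,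
        SeparatesH, SeparatesV, not_false_eq_true, true_imp_iff, false_imp_iff,
        true_and, and_true] at h h' o o' alt
    all_goals
      obtain ⟨h1, h2⟩ := h
      obtain ⟨h1', h2'⟩ := h'
      rcases h2 with ⟨h2, h3⟩ | ⟨h3, h2⟩ <;>
      rcases h2' with ⟨h2', h3'⟩ | ⟨h3', h2'⟩ <;>
      have z := h2 0 (by omega) <;>
      have z' := h2' 0 (by omega) <;>
      first
      | exact absurd (z.trans h3) (by first | exact lt_asymm o | exact lt_asymm (by assumption))
      | exact absurd (h3.trans z) (lt_asymm o)
      | exact absurd (z'.trans h3') (lt_asymm o')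
      | exact absurd (h3'.trans z') (lt_asymm o')
      | (rcases hsplit with rfl | hlt
         · have := h1 (k + 1) le_rfl
           have := h1' (k + 1) le_rfl
           tauto
         · have := h1 i hi
           have := h1' i hi
           have := h2 i hlt
           have := h2' i hlt
           tauto)

/-- The concrete points do form a pin sequence of the word. -/
theorem pinPoint_isPinSequence {w : List PinLetter} (hw : Alternating w) :
    IsPinSequence w (pinPoint w) := by
  have hs : ∀ c : PinLetter, c.sign = 1 ∨ c.sign = -1 := by 
    intro c; cases c <;> simp [PinLetter.sign]
  have hx : ∀ j, 0 ≤ (pinPoint w j).1 ∧ (pinPoint w j).1 ≤ 2 * j ∧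
      |(pinPoint w j).2| ≤ 2 * j := by
    intro j
    rcases j with _ | _ | j
    · simp [pinPoint]
    · rcases hs (w.getD 0 .u) with h | h <;> simp only [pinPoint, h] <;> norm_num
    · simp only [pinPoint]
      split_ifs
      · rcases hs (w.getD j .u) with h | h <;> simp only [h, abs_le] <;> push_cast <;>
          refine ⟨?_, ?_, ?_, ?_⟩ <;> omega
      · rcases hs (w.getD (j + 1) .u) with h | h <;> simp only [h, abs_le] <;> push_cast <;>
          refine ⟨?_, ?_, ?_, ?_⟩ <;> omega
  have hg : ∀ (k : ℕ) (h : k < w.length), w.getD k .u = w[k] := by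
    intro k h; simp [h]
  refine ⟨fun h => ?_, fun k hk => ?_⟩
  · simp only [pinPoint, hg 0 h]
    generalize w[0] = c
    cases c <;> simp [IsFirstPin, PinLetter.sign]
  · have hb : ∀ j ≤ k, (pinPoint w j).1 ≤ 2 * k ∧ (pinPoint w j).2 ≤ 2 * k ∧
        -(2 * (k : ℤ)) ≤ (pinPoint w j).2 := by
      intro j hj
      have h := hx j
      rw [abs_le] at h
      omega
    have h1 : (w[k].isRight = true → (pinPoint w (k + 1)).1 = 2 * k + 2) ∧
        (w[k].isRight = false → (pinPoint w (k + 1)).2 = (2 * k + 2) * w[k].sign) := by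
      rcases k with _ | k
      · simp only [pinPoint, hg 0 (by omega)]
        simp
      · rw [pinPoint, hg (k + 1) (by omega)]
        constructor
        · intro h; rw [if_pos h]; push_cast; ring
        · intro h; rw [if_neg (by simp [h])]; push_cast; ring
    have h0 := hx (k + 1)
    rw [abs_le] at h0
    have h2 : pinPoint w (k + 2) = if w[k + 1].isRight then
        (2 * (k : ℤ) + 4, (2 * (k : ℤ) + 1) * w[k].sign)
      else (2 * (k : ℤ) + 1, (2 * (k : ℤ) + 4) * w[k + 1].sign) := by
      rw [pinPoint, hg (k + 1) hk, hg k (by omega)]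
    have alt := hw k hk
    rw [h2]
    have hsplit : ∀ j ≤ k + 1, j ≤ k ∨ j = k + 1 := fun j hj => by omega
    have hlt : ∀ j < k + 1, j ≤ k := fun j hj => by omega
    generalize w[k + 1] = c at alt
    generalize w[k] = b at alt h1
    cases c <;> cases b <;>
      simp only [PinLetter.isRight, ne_eq, not_true_eq_false, reduceCtorEq, not_false_eq_true,
        PinLetter.sign, true_imp_iff, false_imp_iff, true_and, and_true, IsProperPin,
        SeparatesH, SeparatesV, if_true, if_false, mul_one, Bool.false_eq_true] at alt h1 ⊢
    all_goals
      refine ⟨fun j hj => ?_, ?_⟩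
      · rcases hsplit j hj with h | rfl
        · have := hb j h
          omega
        · push_cast at h0
          omega
      · first
        | exact Or.inl ⟨fun j hj => by have := hb j (hlt j hj); omega, by omega⟩
        | exact Or.inr ⟨by omega, fun j hj => by have := hb j (hlt j hj); omega⟩

/-- For every pin sequence of the word `w`, the pins without the origin are order isomorphic to
`pinPerm w`. -/
theorem pinPerm_isOrderIsoTo {w : List PinLetter} (hw : Alternating w) {p : ℕ → K × K}
    (hp : IsPinSequence w p) : IsOrderIsoTo (pinPerm w) fun k => p ((k : ℕ) + 1) := by
  have hq := pinPoint_isPinSequence hw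
  have key : ∀ a b : Fin w.length,
      ((pinPoint w (a + 1)).1 < (pinPoint w (b + 1)).1 ↔ (p (a + 1)).1 < (p (b + 1)).1) ∧
      ((pinPoint w (a + 1)).2 < (pinPoint w (b + 1)).2 ↔ (p (a + 1)).2 < (p (b + 1)).2) ∧
      (a ≠ b → (pinPoint w (a + 1)).1 ≠ (pinPoint w (b + 1)).1 ∧
        (pinPoint w (a + 1)).2 ≠ (pinPoint w (b + 1)).2) := by
    intro a b
    rcases lt_trichotomy a b with h | rfl | h
    · have := hp.same_order hw hq (i := a + 1) (j := b + 1) (by simpa using h) (by omega)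
      grind
    · simp
    · have := hp.same_order hw hq (i := b + 1) (j := a + 1) (by simpa using h) (by omega)
      grind
  obtain ⟨e, he, hv⟩ := orderPerm_isOrderIsoTo (q := fun k : Fin w.length => pinPoint w (k + 1))
    (fun a b h => by_contra fun hne => ((key a b).2.2 hne).1 h)
    (fun a b h => by_contra fun hne => ((key a b).2.2 hne).2 h)
  exact ⟨e, fun a b h => (key _ _).1.1 (he h), fun a b => (hv a b).trans (key _ _).2.1⟩

end PinFacts

/-! ### Permutation classes -/

/-- The type of all finite permutations, each with its length. -/
abbrev FinPerm : Type := Σ n : ℕ, Equiv.Perm (Fin n)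

/-- `π.Contains σ`: some subsequence of `π` is order isomorphic to `σ`. -/
def FinPerm.Contains (π σ : FinPerm) : Prop :=
  ∃ f : Fin σ.1 ↪o Fin π.1, ∀ a b, σ.2 a < σ.2 b ↔ π.2 (f a) < π.2 (f b)

/-- The downward closure of a set of permutations under containment. -/
def permDownClosure (S : Set FinPerm) : Set FinPerm :=
  {σ | ∃ π ∈ S, FinPerm.Contains π σ}

/-- The permutation class attached to the sequence `s`. -/
def pinClass (s : ℕ → ℕ) : Set FinPerm :=
  permDownClosure {π | ∃ w ∈ pinLanguage s, π = ⟨w.length, pinPerm w⟩}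

/-- The permutations of length `n` in a set of permutations. -/
def ofLength (C : Set FinPerm) (n : ℕ) : Set FinPerm := {π ∈ C | π.1 = n}

/-- The enumeration sequence of a set of permutations: how many members it has of each length. -/
noncomputable def enumeration (C : Set FinPerm) : ℕ → ℕ := fun n => (ofLength C n).ncard

/-! ### The infinite binary words -/

/-! The words α_i are prefixes of one infinite word, the `limitWord` of the sequence 1, s_1, s_2, …,
obtained by composing the substitutions 0 ↦ 0^σ 1^σ, 1 ↦ 1^σ 0^σ. By `mem_pinClass_iff` the class
consists of the permutations found in the single infinite pin sequence of this word, so the task is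
to compare the windows (factors) of two infinite words and to carry the result over to permutations.

Words: `exists_window_length` yields a length m such that every m-window of the t-word occurs in the
s-word, but not conversely. Let a < b be the parameters at the first difference. The a-word contains
e (!e)^a e, whose inner run is too short for the b-word. Windows of that length in the b-word have
at most one switch and occur in the a-word, except constant ones when a = 1. That exception
disappears after one more substitution, and the prepended 1 guarantees that there is one. Both facts
survive the common outer substitutions.

Permutations: the relative position of two pins depends only on their adjacency, the parity of the
later one if they are adjacent, and the letter of the later one. So any 2m pins of the t-sequence
can be moved, run by run, into the s-sequence (`exists_movesPins`). Conversely, two initial pins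
together with 2m - 2 consecutive pins meeting all m letters of a new window form a permutation whose
embeddings all exhibit that window (`markedPins_rigid`). Both statements hold at the same bound 2m,
which serves as N. -/

/-- The image of the word `u` under `0 ↦ 01`, `1 ↦ 10`. -/
def doubling (u : ℕ → Bool) (l : ℕ) : Bool := xor (decide (l % 2 = 1)) (u (l / 2))

/-- The image of the word `u` under `0 ↦ 0^σ 1^σ`, `1 ↦ 1^σ 0^σ`. -/
def expand (σ : ℕ) (u : ℕ → Bool) (k : ℕ) : Bool := doubling u (k / σ)

/-- The infinite word obtained by composing the substitutions `expand (S 0)`, `expand (S 1)`, …. -/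
def limitWord (S : ℕ → ℕ) (k : ℕ) : Bool :=
  -- Position 0 lies in its own block on every level, so the recursion does not decrease there and
  -- the letter has to be prescribed.
  if h : k = 0 then false
  else xor (decide (k / S 0 % 2 = 1)) (limitWord (fun i => S (i + 1)) (k / S 0 / 2))
termination_by k
decreasing_by
  have := Nat.div_le_self k (S 0)
  omega

theorem limitWord_zero (S : ℕ → ℕ) : limitWord S 0 = false := by
  rw [limitWord]; simp

theorem limitWord_eq_expand (S : ℕ → ℕ) :
    limitWord S = expand (S 0) (limitWord fun i => S (i + 1)) := by
  funext k
  rw [limitWord]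
  split_ifs with h
  · subst h
    simp [expand, doubling, limitWord_zero]
  · rfl

theorem doubling_two_mul (u : ℕ → Bool) (j : ℕ) : doubling u (2 * j) = u j := by
  simp [doubling]

theorem doubling_two_mul_add_one (u : ℕ → Bool) (j : ℕ) : doubling u (2 * j + 1) = !u j := by
  have : (2 * j + 1) / 2 = j := by omega
  simp [doubling, this]

theorem expand_mul_add {σ : ℕ} (u : ℕ → Bool) (q : ℕ) {r : ℕ} (hr : r < σ) :
    expand σ u (σ * q + r) = doubling u q := by
  rw [expand, Nat.mul_add_div (by omega), Nat.div_eq_of_lt hr, Nat.add_zero]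

/-- Letters of an expanded word depend on the letter of the block and on the place in it. -/
theorem expand_block {σ : ℕ} (hσ : 0 < σ) (u : ℕ → Bool) (q r : ℕ) :
    expand σ u (2 * σ * q + r) =
      xor (decide (r / σ % 2 = 1)) (u (q + r / (2 * σ))) := by
  have h : (2 * σ * q + r) / σ = 2 * q + r / σ := by
    rw [show 2 * σ * q = σ * (2 * q) by ring, Nat.mul_add_div hσ]
  have h2 : r / (2 * σ) = r / σ / 2 := by rw [Nat.mul_comm, Nat.div_div_eq_div_mul]
  rw [expand, h, doubling, h2]
  congr 2
  · rw [Nat.mul_add_mod]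
  · omega

/-- The length of the blocks of level `i`. -/
def blockLength (S : ℕ → ℕ) (i : ℕ) : ℕ := ∏ j ∈ Finset.range i, (2 * S j)

theorem blockLength_succ (S : ℕ → ℕ) (i : ℕ) :
    blockLength S (i + 1) = blockLength S i * (2 * S i) := Finset.prod_range_succ _ _

theorem blockLength_succ' (S : ℕ → ℕ) (i : ℕ) :
    blockLength S (i + 1) = 2 * S 0 * blockLength (fun j => S (j + 1)) i := by
  rw [blockLength, Finset.prod_range_succ', mul_comm]
  rfl

theorem lt_blockLength {S : ℕ → ℕ} (hS : ∀ k, 0 < S k) (i : ℕ) : i < blockLength S i := by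
  induction i with
  | zero => simp [blockLength]
  | succ i ih =>
    rw [blockLength_succ]
    nlinarith [hS i]

/-- The first i substitutions turn each letter of the remaining word into a block of level i, and
they commute with complementation. Hence every block is the prefix block or its complement. -/
theorem limitWord_block {S : ℕ → ℕ} (hS : ∀ k, 0 < S k) (i q : ℕ) {r : ℕ}
    (hr : r < blockLength S i) :
    limitWord S (blockLength S i * q + r) =
      xor (limitWord (fun j => S (i + j)) q) (limitWord S r) := by
  induction i generalizing S r with
  | zero =>
    obtain rfl : r = 0 := by simpa [blockLength] using hr
    simp [blockLength, limitWord_zero]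
  | succ i ih =>
    rw [blockLength_succ'] at hr ⊢
    have h0 := hS 0
    rw [limitWord_eq_expand S, mul_assoc, expand_block h0]
    have e : r = 2 * S 0 * 0 + r := by ring
    conv_rhs => rw [e, expand_block h0]
    rw [ih (fun k => hS (k + 1)) (Nat.div_lt_of_lt_mul hr)]
    simp only [Nat.zero_add, Nat.add_right_comm i _ 1]
    cases decide (r / S 0 % 2 = 1) <;> simp

/-! ### Recurrence of letters, prefixes and factors -/

theorem exists_limitWord_eq {S : ℕ → ℕ} (hS : ∀ k, 0 < S k) (K : ℕ) (e : Bool) :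
    ∃ q ≥ K, limitWord S q = e := by
  have h0 := hS 0
  have h1 : limitWord S (S 0 * (2 * K) + 0) = limitWord (fun i => S (i + 1)) K := by
    rw [limitWord_eq_expand S, expand_mul_add _ _ h0, doubling_two_mul]
  have h2 : limitWord S (S 0 * (2 * K + 1) + 0) = !limitWord (fun i => S (i + 1)) K := by
    rw [limitWord_eq_expand S, expand_mul_add _ _ h0, doubling_two_mul_add_one]
  by_cases h : limitWord (fun i => S (i + 1)) K = e
  · exact ⟨_, by nlinarith, h1.trans h⟩
  · refine ⟨_, by nlinarith, h2.trans ?_⟩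
    cases e <;> simp_all

/-- Every prefix, and its complement, occurs arbitrarily late. -/
theorem limitWord_prefix_recurrent {S : ℕ → ℕ} (hS : ∀ k, 0 < S k) (K m : ℕ) (e : Bool) :
    ∃ p ≥ K, ∀ r < m, limitWord S (p + r) = xor e (limitWord S r) := by
  obtain ⟨q, hq, he⟩ := exists_limitWord_eq (S := fun j => S (m + j)) (fun _ => hS _) K e
  have hm := lt_blockLength hS m
  refine ⟨blockLength S m * q, by nlinarith, fun r hr => ?_⟩
  rw [limitWord_block hS m q (hr.trans hm), he]

/-- Every factor occurs arbitrarily late. -/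
theorem limitWord_recurrent {S : ℕ → ℕ} (hS : ∀ k, 0 < S k) (K m P : ℕ) :
    ∃ p ≥ K, ∀ r < m, limitWord S (p + r) = limitWord S (P + r) := by
  obtain ⟨p, hp, h⟩ := limitWord_prefix_recurrent hS K (P + m) false
  refine ⟨p + P, by omega, fun r hr => ?_⟩
  rw [add_assoc, h _ (by omega), Bool.false_xor]

/-- Otherwise the word would stay constant after one occurrence of e, but both letters occur
arbitrarily late. -/
theorem exists_limitWord_switch {S : ℕ → ℕ} (hS : ∀ k, 0 < S k) (e : Bool) :
    ∃ j, limitWord S j = e ∧ limitWord S (j + 1) = !e := by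
  by_contra! h
  obtain ⟨p, -, hp⟩ := exists_limitWord_eq hS 0 e
  obtain ⟨q, hq, hq'⟩ := exists_limitWord_eq hS p (!e)
  have : ∀ d, limitWord S (p + d) = e := by
    intro d
    induction d with
    | zero => exact hp
    | succ d ih => have := h _ ih; rw [← add_assoc]; cases e <;> simpa using this
  obtain ⟨d, rfl⟩ := Nat.exists_eq_add_of_le hq
  rw [this d] at hq'
  simp at hq'

/-! ### Windows -/

/-- Every window of length `n` of `y` is a window of `x`. -/
def WindowsOccurIn (y x : ℕ → Bool) (n : ℕ) : Prop :=
  ∀ P, ∃ p, ∀ j < n, x (p + j) = y (P + j)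

/-- Some window of length `n + 2` of `x` is no window of `y`; moreover, its first `n + 1` letters
are not all equal. -/
def HasNewWindow (x y : ℕ → Bool) (n : ℕ) : Prop :=
  ∃ p, (∃ j < n, x (p + j) ≠ x (p + j + 1)) ∧ ∀ P, ∃ j < n + 2, x (p + j) ≠ y (P + j)

/-- Wherever it starts, a window of length 2σn + 2 meets at most n + 2 blocks of length 2σ, and the
bound is attained when it starts with the last letter of a block. -/
theorem WindowsOccurIn.expand {u v : ℕ → Bool} {n σ : ℕ} (hσ : 0 < σ)
    (h : WindowsOccurIn v u (n + 2)) :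
    WindowsOccurIn (expand σ v) (expand σ u) (2 * σ * n + 2) := by
  intro P
  obtain ⟨p, hp⟩ := h (P / (2 * σ))
  have hr := Nat.mod_lt P (show 2 * σ > 0 by omega)
  refine ⟨2 * σ * p + P % (2 * σ), fun j hj => ?_⟩
  conv_rhs => rw [← Nat.div_add_mod P (2 * σ)]
  rw [add_assoc, add_assoc, expand_block hσ, expand_block hσ, hp]
  rw [Nat.div_lt_iff_lt_mul (by omega)]
  nlinarith

theorem dvd_of_expand_ne {σ : ℕ} {u : ℕ → Bool} {k : ℕ}
    (h : expand σ u k ≠ expand σ u (k + 1)) : σ ∣ k + 1 := by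
  by_contra h'
  apply h
  rw [expand, expand, Nat.succ_div, if_neg h', add_zero]

/-- A run that is longer than `σ` ends at a multiple of `σ` that is no multiple of `2 * σ`. -/
theorem two_mul_dvd_of_expand_run {σ : ℕ} (hσ : 0 < σ) {u : ℕ → Bool} {Q : ℕ}
    (h1 : ∀ r < σ, expand σ u (Q + 1 + r) = expand σ u Q)
    (h2 : expand σ u (Q + 1 + σ) ≠ expand σ u Q) : 2 * σ ∣ Q + 1 := by
  have h3 : σ ∣ Q + 1 + σ := by
    have := h1 (σ - 1) (by omega)
    have := dvd_of_expand_ne (σ := σ) (u := u) (k := Q + σ)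
      (by rw [show Q + σ = Q + 1 + (σ - 1) by omega, this,
            show Q + 1 + (σ - 1) + 1 = Q + 1 + σ by omega]; exact h2.symm)
    rwa [show Q + 1 + σ = Q + σ + 1 by omega]
  obtain ⟨c, hc⟩ : σ ∣ Q + 1 := by simpa using h3
  have hc0 : c ≠ 0 := by rintro rfl; omega
  have e : Q = σ * (c - 1) + (σ - 1) := by
    obtain ⟨c, rfl⟩ := Nat.exists_eq_succ_of_ne_zero hc0
    rw [Nat.succ_eq_add_one, mul_add] at hc
    simp only [Nat.succ_eq_add_one, Nat.add_sub_cancel]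
    omega
  have h4 := h1 0 hσ
  rw [add_zero, hc, show σ * c = σ * c + 0 by ring, expand_mul_add _ _ hσ, e,
    expand_mul_add _ _ (by omega)] at h4
  rw [hc, mul_comm 2]
  apply Nat.mul_dvd_mul_left
  -- An odd multiple of σ is the middle of a block, where the letter always changes.
  by_contra hodd
  obtain ⟨d, rfl⟩ : ∃ d, c = 2 * d + 1 := ⟨c / 2, by omega⟩
  rw [doubling_two_mul_add_one, Nat.add_sub_cancel, doubling_two_mul] at h4
  cases h : u d <;> simp_all

theorem expand_first {σ : ℕ} (u : ℕ → Bool) (q : ℕ) {r : ℕ} (hr : r < σ) :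
    expand σ u (2 * σ * q + r) = u q := by
  rw [show 2 * σ * q = σ * (2 * q) by ring, expand_mul_add _ _ hr, doubling_two_mul]

theorem expand_second {σ : ℕ} (u : ℕ → Bool) (q : ℕ) {r : ℕ} (hr : r < σ) :
    expand σ u (2 * σ * q + σ + r) = !u q := by
  rw [show 2 * σ * q + σ = σ * (2 * q + 1) by ring, expand_mul_add _ _ hr,
    doubling_two_mul_add_one]

/-- The new window consists of the last letter of a block, n whole blocks and the first letter of
another block, so it determines n + 2 letters of u once the division into blocks is known. A switch
of u produces a run longer than σ, and `two_mul_dvd_of_expand_run` reads the division off its end.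
The switch must be among the first n + 1 letters so that the block following it lies entirely in the
window. -/
theorem HasNewWindow.expand {u v : ℕ → Bool} {n σ : ℕ} (hσ : 0 < σ)
    (h : HasNewWindow u v n) : HasNewWindow (expand σ u) (expand σ v) (2 * σ * n) := by
  obtain ⟨p, ⟨i, hi, hsw⟩, hnew⟩ := h
  have hlast : ∀ (w : ℕ → Bool) (q : ℕ), _root_.expand σ w (2 * σ * q + (2 * σ - 1)) = !w q := by
    intro w q
    rw [show 2 * σ * q + (2 * σ - 1) = 2 * σ * q + σ + (σ - 1) by omega]
    exact expand_second _ _ (by omega)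
  refine ⟨2 * σ * p + (2 * σ - 1), ⟨σ, by nlinarith, ?_⟩, fun P => ?_⟩
  · have e1 : 2 * σ * p + (2 * σ - 1) + σ = 2 * σ * (p + 1) + (σ - 1) := by
      rw [mul_add]; omega
    have e2 : 2 * σ * (p + 1) + (σ - 1) + 1 = 2 * σ * (p + 1) + σ + 0 := by omega
    rw [e1, e2, expand_first _ _ (by omega), expand_second _ _ hσ]
    simp
  · by_contra! hall
    have key : ∀ k, k < 2 * σ * n + 2 →
        _root_.expand σ v (P + k) = _root_.expand σ u (2 * σ * p + (2 * σ - 1) + k) :=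
      fun k hk => (hall k hk).symm
    have hin : 2 * σ * i + 2 * σ ≤ 2 * σ * n := by nlinarith
    have hfirst : ∀ r < σ, _root_.expand σ u (2 * σ * p + (2 * σ - 1) + (2 * σ * i + 1 + r)) =
        u (p + i + 1) := by
      intro r hr
      rw [show 2 * σ * p + (2 * σ - 1) + (2 * σ * i + 1 + r) = 2 * σ * (p + i + 1) + r by
        simp only [mul_add]; omega]
      exact expand_first _ _ hr
    have hzero : _root_.expand σ u (2 * σ * p + (2 * σ - 1) + 2 * σ * i) = u (p + i + 1) := by
      rw [show 2 * σ * p + (2 * σ - 1) + 2 * σ * i = 2 * σ * (p + i) + (2 * σ - 1) by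
        simp only [mul_add]; omega, hlast]
      cases h : u (p + i) <;> cases h' : u (p + i + 1) <;> simp_all
    have hsec : _root_.expand σ u (2 * σ * p + (2 * σ - 1) + (2 * σ * i + 1 + σ)) =
        !u (p + i + 1) := by
      rw [show 2 * σ * p + (2 * σ - 1) + (2 * σ * i + 1 + σ) = 2 * σ * (p + i + 1) + σ + 0 by
        simp only [mul_add]; omega]
      exact expand_second _ _ hσ
    -- The copy in the expansion of v has the same long run, so it is cut into blocks at the same
    -- places.
    have hd : 2 * σ ∣ P + 2 * σ * i + 1 := by
      apply two_mul_dvd_of_expand_run hσ (u := v)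
      · intro r hr
        rw [show P + 2 * σ * i + 1 + r = P + (2 * σ * i + 1 + r) by ring, key _ (by omega),
          key _ (by omega), hzero, hfirst r hr]
      · rw [show P + 2 * σ * i + 1 + σ = P + (2 * σ * i + 1 + σ) by ring, key _ (by omega),
          key _ (by omega), hzero, hsec]
        simp
    obtain ⟨c, hc⟩ : 2 * σ ∣ P + 1 := by
      rw [show P + 2 * σ * i + 1 = P + 1 + 2 * σ * i by ring] at hd
      exact (Nat.dvd_add_left ⟨i, rfl⟩).1 hd
    obtain ⟨c, rfl⟩ := Nat.exists_eq_succ_of_ne_zero (show c ≠ 0 by rintro rfl; omega)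
    rw [Nat.succ_eq_add_one] at hc
    obtain ⟨j, hj, hne⟩ := hnew c
    apply hne
    rcases j with _ | j
    · have := key 0 (by omega)
      rw [add_zero, add_zero, hlast, show P = 2 * σ * c + (2 * σ - 1) by
        rw [mul_add] at hc; omega, hlast] at this
      simpa using this.symm
    · have h1 : 2 * σ * j ≤ 2 * σ * n := Nat.mul_le_mul_left _ (by omega)
      have := key (2 * σ * j + 1) (by omega)
      rw [show P + (2 * σ * j + 1) = 2 * σ * (c + (j + 1)) + 0 by
          simp only [mul_add] at hc ⊢; omega,
        show 2 * σ * p + (2 * σ - 1) + (2 * σ * j + 1) = 2 * σ * (p + (j + 1)) + 0 by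
          simp only [mul_add] at hc ⊢; omega,
        expand_first _ _ hσ, expand_first _ _ hσ] at this
      exact this.symm

/-! ### Comparison of two limit words -/

/-- The word contains the runs `e^a`, `(!e)^(2a)`, `e^a` one after the other. -/
theorem exists_long_run {S : ℕ → ℕ} (hS : ∀ k, 0 < S k) (e : Bool) :
    ∃ p, (∀ r < S 0, limitWord S (p + r) = e) ∧
      (∀ r < 2 * S 0, limitWord S (p + S 0 + r) = !e) ∧
      ∀ r < S 0, limitWord S (p + 3 * S 0 + r) = e := by
  obtain ⟨j, h1, h2⟩ := exists_limitWord_switch (S := fun i => S (i + 1)) (fun k => hS _) e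
  rw [limitWord_eq_expand S]
  refine ⟨2 * S 0 * j, fun r hr => ?_, fun r hr => ?_, fun r hr => ?_⟩
  · rw [expand_first _ _ hr, h1]
  · rcases lt_or_ge r (S 0) with h | h
    · rw [expand_second _ _ h, h1]
    · obtain ⟨r, rfl⟩ := Nat.exists_eq_add_of_le h
      rw [show 2 * S 0 * j + S 0 + (S 0 + r) = 2 * S 0 * (j + 1) + r by ring,
        expand_first _ _ (by omega), h2]
  · rw [show 2 * S 0 * j + 3 * S 0 + r = 2 * S 0 * (j + 1) + S 0 + r by ring,
      expand_second _ _ hr, h2, Bool.not_not]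

/-- The letters `e (!e)^a e` occur in this order. -/
theorem exists_short_run {S : ℕ → ℕ} (hS : ∀ k, 0 < S k) :
    ∃ p e, limitWord S p = e ∧ (∀ r < S 0, limitWord S (p + 1 + r) = !e) ∧
      limitWord S (p + 1 + S 0) = e := by
  -- A switch two levels up gives two equal adjacent letters one level up; their blocks 1^a 0^a 1^a
  -- 0^a contain 0 1^a 0.
  obtain ⟨j, h1, h2⟩ := exists_limitWord_switch (S := fun i => S (i + 2)) (fun k => hS _) false
  have h0 := hS 0
  have h01 := hS 1
  have hu := limitWord_eq_expand fun i => S (i + 1)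
  have hu1 : limitWord (fun i => S (i + 1)) (2 * S 1 * j + S 1 + (S 1 - 1)) = true := by
    rw [hu, expand_second _ _ (by simp only [zero_add]; omega)]
    simpa using h1
  have hu2 : limitWord (fun i => S (i + 1)) (2 * S 1 * (j + 1) + 0) = true := by
    rw [hu, expand_first _ _ (by simpa using h01)]
    simpa using h2
  obtain ⟨k, hk⟩ : ∃ k, k = 2 * S 1 * j + S 1 + (S 1 - 1) := ⟨_, rfl⟩
  rw [← hk] at hu1
  rw [show 2 * S 1 * (j + 1) + 0 = k + 1 by rw [mul_add]; omega] at hu2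
  rw [limitWord_eq_expand S]
  refine ⟨2 * S 0 * k + S 0 + (S 0 - 1), false, ?_, fun r hr => ?_, ?_⟩
  · rw [expand_second _ _ (by omega), hu1, Bool.not_true]
  · rw [show 2 * S 0 * k + S 0 + (S 0 - 1) + 1 + r = 2 * S 0 * (k + 1) + r by
      rw [mul_add]; omega, expand_first _ _ hr, hu2, Bool.not_false]
  · rw [show 2 * S 0 * k + S 0 + (S 0 - 1) + 1 + S 0 = 2 * S 0 * (k + 1) + S 0 + 0 by
      rw [mul_add]; omega, expand_second _ _ h0, hu2, Bool.not_true]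

/-- In e (!e)^a e the inner run has length a < b, whereas a word expanded by b changes letters only
at multiples of b. -/
theorem hasNewWindow_of_lt {S : ℕ → ℕ} (hS : ∀ k, 0 < S k) {b : ℕ} (hb : S 0 < b)
    (v : ℕ → Bool) : HasNewWindow (limitWord S) (expand b v) (S 0) := by
  obtain ⟨p, e, h1, h2, h3⟩ := exists_short_run hS
  have h0 := hS 0
  refine ⟨p, ⟨0, h0, ?_⟩, fun P => ?_⟩
  · have := h2 0 h0
    rw [add_zero] at this
    rw [add_zero, h1, this]
    simp
  · by_contra! h
    have e0 := h 0 (by omega)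
    have e1 := h 1 (by omega)
    have e3 := h (S 0 + 1) (by omega)
    have h21 := h2 0 h0
    rw [add_zero, add_zero] at e0
    rw [add_zero] at h21
    obtain ⟨c, hc⟩ : b ∣ P + 1 := by
      apply dvd_of_expand_ne (u := v)
      rw [← e0, ← e1, h1, h21]
      simp
    rw [show P + (S 0 + 1) = P + 1 + S 0 by ring, hc, expand_mul_add _ _ hb,
      show p + (S 0 + 1) = p + 1 + S 0 by ring, h3] at e3
    rw [hc, show b * c = b * c + 0 by ring, expand_mul_add _ _ (by omega), h21, ← e3] at e1
    simp at e1

/-- A window of length at most `b + 1` of a word with runs of length at least `b` has at most one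
switch. -/
theorem expand_window_cases {b n : ℕ} (hn : n ≤ b + 1) (hb : 0 < b) (v : ℕ → Bool) (P : ℕ) :
    (∃ f, ∀ j < n, expand b v (P + j) = f) ∨
      ∃ f i, 0 < i ∧ i < n ∧ (∀ j < i, expand b v (P + j) = f) ∧
        ∀ j, i ≤ j → j < n → expand b v (P + j) = !f := by
  have hr := Nat.mod_lt P hb
  have hP := Nat.div_add_mod P b
  obtain ⟨Q, hQ⟩ : ∃ Q, Q = P / b := ⟨_, rfl⟩
  obtain ⟨r, hrr⟩ : ∃ r, r = P % b := ⟨_, rfl⟩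
  rw [← hQ, ← hrr] at hP
  rw [← hrr] at hr
  have hA : ∀ j < b - r, expand b v (P + j) = doubling v Q := by
    intro j hj
    rw [← hP, add_assoc, expand_mul_add _ _ (by omega)]
  have hB : ∀ j, b - r ≤ j → j < n → expand b v (P + j) = doubling v (Q + 1) := by
    intro j hj hjn
    have : P + j = b * (Q + 1) + (j - (b - r)) := by rw [mul_add]; omega
    rw [this, expand_mul_add _ _ (by omega)]
  rcases lt_or_ge (b - r) n with h | h
  · by_cases hd : doubling v (Q + 1) = doubling v Q
    · left
      refine ⟨doubling v Q, fun j hj => ?_⟩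
      rcases lt_or_ge j (b - r) with h' | h'
      · exact hA j h'
      · rw [hB j h' hj, hd]
    · right
      refine ⟨doubling v Q, b - r, by omega, h, hA, fun j h1 h2 => ?_⟩
      rw [hB j h1 h2]
      cases h : doubling v (Q + 1) <;> cases h' : doubling v Q <;> simp_all
  · exact Or.inl ⟨_, fun j hj => hA j (by omega)⟩

/-- The word `limitWord S` contains all windows with at most one switch, except for the constant
windows when `S 0 = 1`. -/
theorem limitWord_contains_switch {S : ℕ → ℕ} (hS : ∀ k, 0 < S k) {n i : ℕ} (hn : n = S 0 + 2)
    (f : Bool) (hi : 0 < i) (hin : i < n) :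
    ∃ p, (∀ j < i, limitWord S (p + j) = f) ∧
      ∀ j, i ≤ j → j < n → limitWord S (p + j) = !f := by
  have h0 := hS 0
  rcases Nat.lt_or_ge (S 0) i with h | h
  · obtain ⟨p, -, h2, h3⟩ := exists_long_run hS (!f)
    refine ⟨p + S 0 + (2 * S 0 - i), fun j hj => ?_, fun j h1 hj => ?_⟩
    · rw [add_assoc, h2 _ (by omega), Bool.not_not]
    · rw [show p + S 0 + (2 * S 0 - i) + j = p + 3 * S 0 + (j - i) by omega, h3 _ (by omega)]
  · obtain ⟨p, h1, h2, -⟩ := exists_long_run hS f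
    refine ⟨p + (S 0 - i), fun j hj => ?_, fun j h1 hj => ?_⟩
    · rw [add_assoc, h1 _ (by omega)]
    · rw [show p + (S 0 - i) + j = p + S 0 + (j - i) by omega, h2 _ (by omega)]

theorem limitWord_contains_const {S : ℕ → ℕ} (hS : ∀ k, 0 < S k) (f : Bool) :
    ∃ p, ∀ j < 2 * S 0, limitWord S (p + j) = f := by
  obtain ⟨p, -, h2, -⟩ := exists_long_run hS (!f)
  exact ⟨p + S 0, fun j hj => by rw [h2 j hj, Bool.not_not]⟩

/-- With a = `S 0`, such a window meets at most a + 2 ≤ b + 1 letters of `expand b v`, hence at most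
one switch. The a-word has all one-switch windows of this length and constant ones of length 2a;
only a = 1 leaves a constant window of length a + 2 uncovered. -/
theorem windowsOccurIn_expand_expand {S : ℕ → ℕ} (hS : ∀ k, 0 < S k) {b σ : ℕ} (hσ : 0 < σ)
    (hb : S 0 < b) (v : ℕ → Bool) :
    WindowsOccurIn (expand σ (expand b v)) (expand σ (limitWord S)) (2 * σ * S 0 + 2) := by
  intro P
  have h0 := hS 0
  have hr := Nat.mod_lt P (show 2 * σ > 0 by omega)
  have hPr := (Nat.div_add_mod P (2 * σ)).symm
  obtain ⟨q, hq⟩ : ∃ q, q = P / (2 * σ) := ⟨_, rfl⟩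
  obtain ⟨r, hrr⟩ : ∃ r, r = P % (2 * σ) := ⟨_, rfl⟩
  rw [← hq, ← hrr] at hPr
  rw [← hrr] at hr
  have main : ∀ {n : ℕ}, r + 2 * σ * S 0 + 1 < 2 * σ * n → ∀ p,
      (∀ j < n, limitWord S (p + j) = expand b v (q + j)) →
      ∃ p, ∀ j < 2 * σ * S 0 + 2,
        expand σ (limitWord S) (p + j) = expand σ (expand b v) (P + j) := by
    intro n hn p hp
    refine ⟨2 * σ * p + r, fun j hj => ?_⟩
    rw [hPr, add_assoc, add_assoc, expand_block hσ, expand_block hσ,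
      hp _ (Nat.div_lt_of_lt_mul (show r + j < 2 * σ * n by omega))]
  rcases expand_window_cases (b := b) (n := S 0 + 2) (by omega) (by omega) v q with
    ⟨f, hf⟩ | ⟨f, i, hi, hin, h1, h2⟩
  · obtain ⟨p, hp⟩ := limitWord_contains_const hS f
    rcases Nat.lt_or_ge r (2 * σ - 1) with h | h
    · refine main (n := S 0 + 1) (by rw [mul_add]; omega) p fun j hj => ?_
      rw [hp j (by omega), hf j (by omega)]
    · rcases Nat.lt_or_ge 1 (S 0) with h' | h'
      · refine main (n := S 0 + 2) (by rw [mul_add]; omega) p fun j hj => ?_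
        rw [hp j (by omega), hf j hj]
      -- The word fff is missing, but the window (!f) f^σ (!f)^σ f also occurs in the expansion of
      -- (!f)(!f), shifted by half a block.
      · have hS1 : S 0 = 1 := by omega
        obtain ⟨p, hp⟩ := limitWord_contains_const hS (!f)
        rw [hS1] at hp hf ⊢
        refine ⟨2 * σ * p + (σ - 1), fun j hj => ?_⟩
        rw [hPr, add_assoc, add_assoc, expand_block hσ, expand_block hσ,
          hp _ (Nat.div_lt_of_lt_mul (show σ - 1 + j < 2 * σ * (2 * 1) by omega)),
          hf _ (Nat.div_lt_of_lt_mul (show r + j < 2 * σ * (1 + 2) by omega)),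
          show r + j = σ * 1 + (σ - 1 + j) by omega, Nat.mul_add_div hσ]
        rcases Nat.mod_two_eq_zero_or_one ((σ - 1 + j) / σ) with h | h <;>
          simp [Nat.add_mod, h]
  · obtain ⟨p, g1, g2⟩ := limitWord_contains_switch hS rfl f hi hin
    refine main (n := S 0 + 2) (by rw [mul_add]; omega) p fun j hj => ?_
    rcases Nat.lt_or_ge j i with h | h
    · rw [g1 j h, h1 j h]
    · rw [g2 j h hj, h2 j h hj]

/-- Two limit words whose parameters first differ at a positive index have a common length of
windows where the one with the smaller parameter has strictly more windows. -/
theorem exists_window_length (I : ℕ) {S S' : ℕ → ℕ} (hS : ∀ k, 0 < S k) (hS' : ∀ k, 0 < S' k)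
    (heq : ∀ i ≤ I, S i = S' i) (hlt : S (I + 1) < S' (I + 1)) :
    ∃ n ≥ 2, WindowsOccurIn (limitWord S') (limitWord S) (n + 2) ∧
      HasNewWindow (limitWord S) (limitWord S') n := by
  induction I generalizing S S' with
  | zero =>
    have h0 := hS 0
    have h1 := hS 1
    refine ⟨2 * S 0 * S 1, by nlinarith, ?_, ?_⟩
    · rw [limitWord_eq_expand S, limitWord_eq_expand S', ← heq 0 le_rfl,
        limitWord_eq_expand fun i => S' (i + 1)]
      exact windowsOccurIn_expand_expand (S := fun i => S (i + 1)) (fun k => hS _) h0 hlt _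
    · rw [limitWord_eq_expand S, limitWord_eq_expand S', ← heq 0 le_rfl,
        limitWord_eq_expand fun i => S' (i + 1)]
      exact (hasNewWindow_of_lt (S := fun i => S (i + 1)) (fun k => hS _) hlt _).expand h0
  | succ I ih =>
    obtain ⟨n, hn, h1, h2⟩ := ih (S := fun i => S (i + 1)) (S' := fun i => S' (i + 1))
      (fun k => hS _) (fun k => hS' _) (fun i hi => heq _ (by omega)) hlt
    have h0 := hS 0
    refine ⟨2 * S 0 * n, by nlinarith, ?_, ?_⟩
    · rw [limitWord_eq_expand S, limitWord_eq_expand S', ← heq 0 (by omega)]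
      exact h1.expand h0
    · rw [limitWord_eq_expand S, limitWord_eq_expand S', ← heq 0 (by omega)]
      exact h2.expand h0

/-! ### The words `α_i` as prefixes of a limit word -/

/-- The sequence `1, s 0, s 1, …`. -/
def consOne (s : ℕ → ℕ) : ℕ → ℕ
  | 0 => 1
  | i + 1 => s i

theorem consOne_pos {s : ℕ → ℕ} (hs : ∀ k, 0 < s k) : ∀ k, 0 < consOne s k
  | 0 => Nat.one_pos
  | k + 1 => hs k

theorem wordPow_map_range {A : Type*} (f : ℕ → A) (L k : ℕ) :
    wordPow ((List.range L).map f) k = (List.range (L * k)).map fun r => f (r % L) := by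
  induction k with
  | zero => simp [wordPow]
  | succ k ih =>
    have h : wordPow ((List.range L).map f) (k + 1) =
        wordPow ((List.range L).map f) k ++ (List.range L).map f := by
      simp [wordPow, List.replicate_succ']
    rw [h, ih, mul_add, mul_one, List.range_add, List.map_append, List.map_map]
    congr 1
    apply List.map_congr_left
    intro r hr
    simp [Nat.mod_eq_of_lt (List.mem_range.1 hr)]

theorem limitWord_of_lt {S : ℕ → ℕ} {q : ℕ} (hq : q < S 0) : limitWord S q = false := by
  have := expand_first (σ := S 0) (limitWord fun i => S (i + 1)) 0 hq
  rwa [← limitWord_eq_expand, mul_zero, zero_add, limitWord_zero] at this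

theorem limitWord_of_ge {S : ℕ → ℕ} {q : ℕ} (hq : q < S 0) : limitWord S (S 0 + q) = true := by
  have := expand_second (σ := S 0) (limitWord fun i => S (i + 1)) 0 hq
  rwa [← limitWord_eq_expand, mul_zero, zero_add, limitWord_zero] at this

/-- The next level begins with `s i` letters 0 and `s i` letters 1, which stand for copies of the
current prefix block and of its complement. The prepended 1 accounts for α_1 = 01. -/
theorem alphaWord_eq_map_range {s : ℕ → ℕ} (hs : ∀ k, 0 < s k) (i : ℕ) :
    alphaWord s i =
      (List.range (blockLength (consOne s) (i + 1))).map (limitWord (consOne s)) := by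
  have hc := consOne_pos hs
  induction i with
  | zero =>
    have h0 : limitWord (consOne s) 0 = false := limitWord_zero _
    have h1 : limitWord (consOne s) 1 = true := limitWord_of_ge (S := consOne s) (q := 0) (hc 0)
    have : blockLength (consOne s) (0 + 1) = 2 := by simp [blockLength, consOne]
    rw [this]
    simp [alphaWord, List.range_succ, h0, h1]
  | succ i ih =>
    have hL : 0 < blockLength (consOne s) (i + 1) := by
      have := lt_blockLength hc (i + 1)
      omega
    have hT : ∀ r, limitWord (consOne s) r =
        xor (limitWord (fun j => consOne s (i + 1 + j)) (r / blockLength (consOne s) (i + 1)))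
          (limitWord (consOne s) (r % blockLength (consOne s) (i + 1))) := by
      intro r
      rw [← limitWord_block hc _ _ (Nat.mod_lt _ hL), Nat.div_add_mod]
    rw [blockLength_succ _ (i + 1), alphaWord, ih]
    generalize blockLength (consOne s) (i + 1) = L at hL hT
    have hcm : complementWord ((List.range L).map (limitWord (consOne s))) =
        (List.range L).map fun r => !limitWord (consOne s) r := by
      simp [complementWord]
    rw [hcm, wordPow_map_range, wordPow_map_range,
      show L * (2 * consOne s (i + 1)) = L * s i + L * s i by simp only [consOne]; ring,
      List.range_add, List.map_append, List.map_map]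
    congr 1
    · apply List.map_congr_left
      intro r hr
      rw [List.mem_range] at hr
      have hd : r / L < s i := Nat.div_lt_of_lt_mul hr
      rw [hT r, limitWord_of_lt (S := fun j => consOne s (i + 1 + j)) hd, Bool.false_xor]
    · apply List.map_congr_left
      intro r hr
      rw [List.mem_range] at hr
      have hd : r / L < s i := Nat.div_lt_of_lt_mul hr
      have := limitWord_of_ge (S := fun j => consOne s (i + 1 + j)) (q := r / L) hd
      rw [Function.comp_apply, hT (L * s i + r), Nat.mul_add_mod, Nat.mul_add_div hL,
        show limitWord (fun j => consOne s (i + 1 + j)) (s i + r / L) = true from this,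
        Bool.true_xor]

/-! ### The infinite pin sequence of an infinite binary word -/

/-- The letters of the image of the infinite word `x` under `ρ`. -/
def infinitePinWord (x : ℕ → Bool) (j : ℕ) : PinLetter :=
  if j % 2 = 0 then (if x (j / 2) then .u else .d) else (if x (j / 2) then .ru else .rd)

theorem rho_map_range (x : ℕ → Bool) (n : ℕ) :
    rho ((List.range n).map x) = (List.range (2 * n)).map (infinitePinWord x) := by
  induction n with
  | zero => simp [rho]
  | succ n ih =>
    have h : rho ((List.range (n + 1)).map x) = rho ((List.range n).map x) ++ rho [x n] := by
      simp [rho, List.range_succ]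
    have e1 : (2 * n + 1) % 2 = 1 := by omega
    have e2 : (2 * n + 1) / 2 = n := by omega
    rw [h, ih, show 2 * (n + 1) = 2 * n + 1 + 1 by ring, List.range_succ, List.range_succ]
    cases hx : x n <;> simp [rho, infinitePinWord, e1, e2, hx]

theorem eq_map_range_of_infix {A : Type*} {f : ℕ → A} {n : ℕ} {v : List A}
    (h : v <:+: (List.range n).map f) :
    ∃ o, v = (List.range v.length).map fun k => f (o + k) := by
  obtain ⟨a, b, h⟩ := h
  refine ⟨a.length, List.ext_getElem (by simp) fun k hk _ => ?_⟩
  have h1 : a.length + k < n := by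
    have := congrArg List.length h
    simp at this
    omega
  have h2 : (a ++ v ++ b)[a.length + k]? = some v[k] := by
    rw [List.append_assoc, List.getElem?_append_right (by omega), Nat.add_sub_cancel_left,
      List.getElem?_append_left hk, List.getElem?_eq_getElem hk]
  rw [h] at h2
  simpa [h1] using h2.symm

/-- The sign `1` or `-1` of the pin `j`. -/
def pinSign (x : ℕ → Bool) (j : ℕ) : ℤ := if x (j / 2) then 1 else -1

/-- The pins of the infinite pin sequence. -/
def infinitePin (x : ℕ → Bool) (j : ℕ) : ℤ × ℤ :=
  if j % 2 = 0 then (2 * j - 1, (2 * j + 2) * pinSign x j)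
  else (2 * j + 2, (2 * j - 1) * pinSign x j)

theorem infinitePin_even (x : ℕ → Bool) {j : ℕ} (h : j % 2 = 0) :
    infinitePin x j = (2 * (j : ℤ) - 1, (2 * (j : ℤ) + 2) * pinSign x j) := if_pos h

theorem infinitePin_odd (x : ℕ → Bool) {j : ℕ} (h : j % 2 = 1) :
    infinitePin x j = (2 * (j : ℤ) + 2, (2 * (j : ℤ) - 1) * pinSign x j) := if_neg (by omega)

theorem pinSign_cases (x : ℕ → Bool) (j : ℕ) :
    (x (j / 2) = true ∧ pinSign x j = 1) ∨ (x (j / 2) = false ∧ pinSign x j = -1) := by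
  cases h : x (j / 2) <;> simp [pinSign, h]

/-! ### Relative order of the pins -/

theorem pinX_lt_iff (x : ℕ → Bool) {i j : ℕ} (hij : i < j) :
    (infinitePin x i).1 < (infinitePin x j).1 ↔ ¬(i + 1 = j ∧ j % 2 = 0) := by
  simp only [infinitePin]
  split_ifs <;> simp only <;> omega

theorem pinX_ne (x : ℕ → Bool) {i j : ℕ} (hij : i < j) :
    (infinitePin x i).1 ≠ (infinitePin x j).1 := by
  simp only [infinitePin]
  split_ifs <;> simp only <;> omega

theorem pinX_injective (x : ℕ → Bool) : Function.Injective fun j => (infinitePin x j).1 := by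
  intro i j h
  rcases lt_trichotomy i j with h' | h' | h'
  · exact absurd h (pinX_ne x h')
  · exact h'
  · exact absurd h.symm (pinX_ne x h')

/-- A later pin lies on the side given by its letter, except that a right pin falls just short of
the vertical pin immediately before it, which has the same letter. -/
theorem pinY_lt_iff (x : ℕ → Bool) {i j : ℕ} (hij : i < j) :
    ((infinitePin x i).2 < (infinitePin x j).2 ↔
      (x (j / 2) = true ↔ ¬(i + 1 = j ∧ j % 2 = 1))) ∧
    (infinitePin x i).2 ≠ (infinitePin x j).2 := by
  have hs : i + 1 = j → j % 2 = 1 → pinSign x i = pinSign x j := by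
    intro h1 h2
    rw [pinSign, pinSign, show i / 2 = j / 2 by omega]
  simp only [infinitePin]
  rcases pinSign_cases x i with ⟨-, h⟩ | ⟨-, h⟩ <;>
    rcases pinSign_cases x j with ⟨h', h''⟩ | ⟨h', h''⟩ <;>
    rw [h, h''] at hs ⊢ <;> rw [h'] <;> split_ifs <;>
    simp only [true_iff, false_iff] <;> omega

theorem pinY_injective (x : ℕ → Bool) : Function.Injective fun j => (infinitePin x j).2 := by
  intro i j h
  rcases lt_trichotomy i j with h' | h' | h'
  · exact absurd h (pinY_lt_iff x h').2
  · exact h'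
  · exact absurd h.symm (pinY_lt_iff x h').2

theorem alternating_infinitePinWord (x : ℕ → Bool) (o m : ℕ) :
    Alternating ((List.range m).map fun k => infinitePinWord x (o + k)) := by
  intro i h
  simp only [List.getElem_map, List.getElem_range, infinitePinWord]
  rcases Nat.mod_two_eq_zero_or_one (o + i) with h1 | h1
  · have h2 : (o + (i + 1)) % 2 = 1 := by omega
    simp only [h1, h2]
    cases x ((o + i) / 2) <;> cases x ((o + (i + 1)) / 2) <;> simp [PinLetter.isRight]
  · have h2 : (o + (i + 1)) % 2 = 0 := by omega
    simp only [h1, h2]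
    cases x ((o + i) / 2) <;> cases x ((o + (i + 1)) / 2) <;> simp [PinLetter.isRight]

/-- Any stretch of the infinite sequence may be regarded as starting afresh, with the origin placed
at (-2, 0), to the left of all pins. -/
theorem infinitePin_isPinSequence (x : ℕ → Bool) (o m : ℕ) :
    IsPinSequence ((List.range m).map fun k => infinitePinWord x (o + k))
      fun k => if k = 0 then (-2, 0) else infinitePin x (o + k - 1) := by
  refine ⟨fun h => ?_, fun i h => ?_⟩
  · simp only [List.getElem_map, List.getElem_range, infinitePinWord, add_zero,
      one_ne_zero, if_true, if_false, Nat.add_sub_cancel]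
    rcases Nat.mod_two_eq_zero_or_one o with h0 | h0
    · rw [infinitePin_even x h0, if_pos h0]
      rcases pinSign_cases x o with ⟨h1, h2⟩ | ⟨h1, h2⟩ <;> rw [h1, h2] <;>
        simp only [if_true, if_false, IsFirstPin, Bool.false_eq_true] <;> omega
    · rw [infinitePin_odd x h0, if_neg (by omega)]
      rcases pinSign_cases x o with ⟨h1, h2⟩ | ⟨h1, h2⟩ <;> rw [h1, h2] <;>
        simp only [if_true, if_false, IsFirstPin, Bool.false_eq_true] <;> omega
  -- The points before the latest pin stay within distance 2(o + i), which leaves room for the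
  -- separating coordinate 2(o + i + 1) - 1 of the new pin.
  · have key : ∀ j ≤ i + 1, j ≠ i + 1 →
        (if j = 0 then ((-2, 0) : ℤ × ℤ) else infinitePin x (o + j - 1)).1 ≤ 2 * (o + i : ℕ) ∧
        (if j = 0 then ((-2, 0) : ℤ × ℤ) else infinitePin x (o + j - 1)).2 ≤ 2 * (o + i : ℕ) ∧
        -(2 * (o + i : ℕ) : ℤ) ≤
          (if j = 0 then ((-2, 0) : ℤ × ℤ) else infinitePin x (o + j - 1)).2 := by
      intro j hj hj'
      split_ifs with h0
      · simp only; omega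
      · simp only [infinitePin]
        rcases pinSign_cases x (o + j - 1) with ⟨-, h2⟩ | ⟨-, h2⟩ <;> rw [h2] <;>
          split_ifs <;> simp only <;> omega
    have hlast : (if i + 1 = 0 then ((-2, 0) : ℤ × ℤ) else infinitePin x (o + (i + 1) - 1)) =
        infinitePin x (o + i) := by
      simp
    have hnew : (if i + 2 = 0 then ((-2, 0) : ℤ × ℤ) else infinitePin x (o + (i + 2) - 1)) =
        infinitePin x (o + i + 1) := by
      simp [← add_assoc]
    have hsplit : ∀ j ≤ i + 1, j = i + 1 ∨ (j ≤ i + 1 ∧ j ≠ i + 1) := fun j hj => by omega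
    have hs : (o + i) % 2 = 0 → pinSign x (o + i) = pinSign x (o + i + 1) := by
      intro h1
      rw [pinSign, pinSign, show (o + i) / 2 = (o + i + 1) / 2 by omega]
    simp only [List.getElem_map, List.getElem_range, infinitePinWord]
    rw [hnew, ← add_assoc]
    rcases Nat.mod_two_eq_zero_or_one (o + i) with h1 | h1
    · have h2 : (o + i + 1) % 2 = 1 := by omega
      rcases pinSign_cases x (o + i + 1) with ⟨g1, g2⟩ | ⟨g1, g2⟩ <;>
      · have g3 := hs h1
        rw [g2] at g3
        simp only [h2, g1, one_ne_zero, if_true, if_false, IsProperPin, SeparatesV, hlast,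
          Bool.false_eq_true]
        rw [infinitePin_odd x h2, g2]
        refine ⟨fun j hj => ?_, ?_⟩
        · rcases hsplit j hj with rfl | ⟨h3, h4⟩
          · rw [hlast, infinitePin_even x h1]
            push_cast; omega
          · have := key j h3 h4
            push_cast at *; omega
        · rw [infinitePin_even x h1, g3]
          first
          | refine Or.inl ⟨fun j hj => ?_, by push_cast; omega⟩
            have := key j (by omega) (by omega)
            push_cast at *; omega
          | refine Or.inr ⟨by push_cast; omega, fun j hj => ?_⟩
            have := key j (by omega) (by omega)
            push_cast at *; omega
    · have h2 : (o + i + 1) % 2 = 0 := by omega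
      rcases pinSign_cases x (o + i + 1) with ⟨g1, g2⟩ | ⟨g1, g2⟩ <;>
      · simp only [h2, g1, if_true, IsProperPin, SeparatesH, hlast, Bool.false_eq_true, if_false]
        rw [infinitePin_even x h2, g2]
        refine ⟨fun j hj => ?_, ?_⟩
        · rcases hsplit j hj with rfl | ⟨h3, h4⟩
          · rw [hlast, infinitePin_odd x h1]
            rcases pinSign_cases x (o + i) with ⟨-, g4⟩ | ⟨-, g4⟩ <;> rw [g4] <;>
              push_cast <;> omega
          · have := key j h3 h4
            push_cast at *; omega
        · rw [infinitePin_odd x h1]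
          refine Or.inl ⟨fun j hj => ?_, by push_cast; omega⟩
          have := key j (by omega) (by omega)
          push_cast at *; omega

/-- The pins `g 0, g 1, …` of the infinite pin sequence form, from left to right, the
permutation `π`. -/
def EmbedsVia (x : ℕ → Bool) {n : ℕ} (π : Equiv.Perm (Fin n)) (g : Fin n → ℕ) : Prop :=
  StrictMono (fun a => (infinitePin x (g a)).1) ∧
    ∀ a b, π a < π b ↔ (infinitePin x (g a)).2 < (infinitePin x (g b)).2

theorem pinPerm_infinitePinWord (x : ℕ → Bool) (o m : ℕ) {v : List PinLetter}
    (hv : v = (List.range m).map fun k => infinitePinWord x (o + k)) :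
    IsOrderIsoTo (pinPerm v) fun k : Fin v.length => infinitePin x (o + k) := by
  subst hv
  have := pinPerm_isOrderIsoTo (alternating_infinitePinWord x o m)
    (infinitePin_isPinSequence x o m)
  simpa [← add_assoc] using this

/-- Words in the pin language are factors of the infinite pin word, and finitely many pins already
lie in the image of a single α_i. -/
theorem mem_pinClass_iff {s : ℕ → ℕ} (hs : ∀ k, 0 < s k) {n : ℕ} (π : Equiv.Perm (Fin n)) :
    (⟨n, π⟩ : FinPerm) ∈ pinClass s ↔ ∃ g, EmbedsVia (limitWord (consOne s)) π g := by
  constructor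
  · rintro ⟨_, ⟨v, ⟨_, ⟨w, ⟨_, ⟨i, rfl⟩, hw⟩, rfl⟩, hv⟩, rfl⟩, f, hf⟩
    obtain ⟨a, b, hab⟩ := hw
    have hv' : v <:+: rho (alphaWord s i) := by
      refine hv.trans ⟨rho a, rho b, ?_⟩
      rw [← hab]
      simp [rho]
    rw [alphaWord_eq_map_range hs, rho_map_range] at hv'
    obtain ⟨o, ho⟩ := eq_map_range_of_infix hv'
    obtain ⟨e, he1, he2⟩ := pinPerm_infinitePinWord _ o _ ho
    exact ⟨fun a => o + e (f a), fun a b h => he1 (f.lt_iff_lt.2 h),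
      fun a b => (hf a b).trans (he2 _ _)⟩
  · rintro ⟨g, hg1, hg2⟩
    obtain ⟨i, hi⟩ : ∃ i, ∀ a, g a ≤ i := by
      obtain ⟨B, hB⟩ := (Set.finite_range g).bddAbove
      exact ⟨B, fun a => hB ⟨a, rfl⟩⟩
    have hlen : (rho (alphaWord s i)).length = 2 * blockLength (consOne s) (i + 1) := by
      rw [alphaWord_eq_map_range hs, rho_map_range]
      simp
    have hlt : ∀ a, g a < (rho (alphaWord s i)).length := by
      intro a
      have := lt_blockLength (consOne_pos hs) (i + 1)
      have := hi a
      omega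
    obtain ⟨e, he1, he2⟩ := pinPerm_infinitePinWord (limitWord (consOne s)) 0
      (2 * blockLength (consOne s) (i + 1)) (v := rho (alphaWord s i))
      (by rw [alphaWord_eq_map_range hs, rho_map_range]; simp)
    refine ⟨_, ⟨rho (alphaWord s i), ⟨_, ⟨_, ⟨_, ⟨i, rfl⟩, List.infix_rfl⟩, rfl⟩,
      List.infix_rfl⟩, rfl⟩, OrderEmbedding.ofStrictMono (fun a => e.symm ⟨g a, hlt a⟩) ?_, ?_⟩
    · intro a b hab
      rw [← he1.lt_iff_lt]
      simpa using hg1 hab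
    · intro a b
      refine (hg2 a b).trans ?_
      have := he2 (e.symm ⟨g a, hlt a⟩) (e.symm ⟨g b, hlt b⟩)
      simp only [Equiv.apply_symm_apply, zero_add] at this
      exact this.symm

/-! ### Moving pins from one pin sequence to another -/

/-- The map `φ` moves the pins in `T` of the pin sequence of `y` to pins of the pin sequence of `x`
in such a way that their relative positions are preserved. -/
def MovesPins (y x : ℕ → Bool) (T : Finset ℕ) (φ : ℕ → ℕ) : Prop :=
  ∀ i ∈ T, ∀ j ∈ T, i < j → φ i < φ j ∧ (φ i + 1 = φ j ↔ i + 1 = j) ∧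
    (i + 1 = j → φ j % 2 = j % 2) ∧ x (φ j / 2) = y (j / 2)

theorem lt_iff_lt_of_lt_iff {A B : Type*} [LinearOrder A] [LinearOrder B] {a a' : A} {b b' : B}
    (ha : a ≠ a') (hb : b ≠ b') (h : a < a' ↔ b < b') : a' < a ↔ b' < b := by
  rw [← not_lt_iff_eq_or_lt.trans (or_iff_right ha),
    ← not_lt_iff_eq_or_lt.trans (or_iff_right hb), h]

theorem MovesPins.embedsVia {y x : ℕ → Bool} {n : ℕ} {π : Equiv.Perm (Fin n)} {g : Fin n → ℕ}
    {φ : ℕ → ℕ} (h : MovesPins y x (Finset.univ.image g) φ) (hg : EmbedsVia y π g) :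
    EmbedsVia x π (φ ∘ g) := by
  have key : ∀ a b, g a < g b →
      ((infinitePin y (g a)).1 < (infinitePin y (g b)).1 ↔
        (infinitePin x (φ (g a))).1 < (infinitePin x (φ (g b))).1) ∧
      ((infinitePin y (g a)).2 < (infinitePin y (g b)).2 ↔
        (infinitePin x (φ (g a))).2 < (infinitePin x (φ (g b))).2) ∧ φ (g a) < φ (g b) := by
    intro a b hab
    obtain ⟨h1, h2, h3, h4⟩ := h (g a) (by simp) (g b) (by simp) hab
    rw [pinX_lt_iff _ hab, pinX_lt_iff _ h1, (pinY_lt_iff _ hab).1, (pinY_lt_iff _ h1).1, h4, h2]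
    refine ⟨?_, ?_, h1⟩
    · by_cases h5 : g a + 1 = g b
      · rw [h3 h5]
      · simp [h5]
    · by_cases h5 : g a + 1 = g b
      · rw [h3 h5]
      · simp [h5]
  refine ⟨fun a b hab => ?_, fun a b => ?_⟩
  · have h1 := hg.1 hab
    simp only [Function.comp_apply] at h1 ⊢
    rcases lt_trichotomy (g a) (g b) with h' | h' | h'
    · exact (key a b h').1.1 h1
    · rw [h'] at h1; exact absurd h1 (lt_irrefl _)
    · obtain ⟨k1, -, k3⟩ := key b a h'
      exact (lt_iff_lt_of_lt_iff (pinX_ne y h') (pinX_ne x k3) k1).1 h1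
  · rw [hg.2]
    simp only [Function.comp_apply]
    rcases lt_trichotomy (g a) (g b) with h' | h' | h'
    · exact (key a b h').2.1
    · rw [h']; simp
    · obtain ⟨-, k2, k3⟩ := key b a h'
      exact lt_iff_lt_of_lt_iff (pinY_lt_iff y h').2 (pinY_lt_iff x k3).2 k2

/-- Pins can be moved if each run of consecutive pins among them covers at most `m` letters. -/
theorem exists_movesPins_of_runs {y x : ℕ → Bool} {m : ℕ}
    (hw : ∀ K P, ∃ p ≥ K, ∀ r < m, x (p + r) = y (P + r)) (T : Finset ℕ)
    (hT : ∀ q M, q ≤ M → (∀ k, q ≤ k → k ≤ M → k ∈ T) → M / 2 < q / 2 + m) :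
    ∃ φ, MovesPins y x T φ := by
  classical
  induction T using Finset.strongInduction with
  | H T ih =>
    rcases T.eq_empty_or_nonempty with rfl | hne
    · exact ⟨id, fun i hi => by simp at hi⟩
    obtain ⟨M, hM⟩ : ∃ M, M = T.max' hne := ⟨_, rfl⟩
    have hMT : M ∈ T := hM ▸ T.max'_mem hne
    have hmax : ∀ k ∈ T, k ≤ M := fun k hk => hM ▸ T.le_max' k hk
    have hex : ∃ q, q ≤ M ∧ ∀ k, q ≤ k → k ≤ M → k ∈ T :=
      ⟨M, le_rfl, fun k h1 h2 => by rwa [le_antisymm h2 h1]⟩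
    obtain ⟨q, hq, hmin⟩ : ∃ q, (q ≤ M ∧ ∀ k, q ≤ k → k ≤ M → k ∈ T) ∧
        ∀ q' < q, ¬(q' ≤ M ∧ ∀ k, q' ≤ k → k ≤ M → k ∈ T) :=
      ⟨Nat.find hex, Nat.find_spec hex, fun q' h => Nat.find_min hex h⟩
    -- The last maximal run starts at q, so the pin before it is missing and the run can be moved
    -- independently of the others.
    have hgap : ∀ i ∈ T, i < q → i + 1 < q := by
      intro i hi hiq
      by_contra hcon
      refine hmin i hiq ⟨by omega, fun k h1 h2 => ?_⟩
      rcases eq_or_lt_of_le h1 with rfl | h1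
      · exact hi
      · exact hq.2 k (by omega) h2
    obtain ⟨φ, hφ⟩ := ih (T.filter (· < q))
      (Finset.filter_ssubset.2 ⟨M, hMT, by omega⟩)
      fun q' M' h1 h2 => hT q' M' h1 fun k h3 h4 => Finset.mem_of_mem_filter k (h2 k h3 h4)
    obtain ⟨p, hp, hpw⟩ := hw ((T.filter (· < q)).sup φ + 2) (q / 2)
    have hlen := hT q M hq.1 hq.2
    -- The last run is shifted by an even amount, which keeps parities, and beyond all pins placed
    -- so far with a gap.
    refine ⟨fun k => if k < q then φ k else k - 2 * (q / 2) + 2 * p, fun i hi j hj hij => ?_⟩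
    have hx : q ≤ j → x ((j - 2 * (q / 2) + 2 * p) / 2) = y (j / 2) := by
      intro hqj
      have := hpw (j / 2 - q / 2) (by have := hmax j hj; omega)
      rwa [show q / 2 + (j / 2 - q / 2) = j / 2 by omega,
        show p + (j / 2 - q / 2) = (j - 2 * (q / 2) + 2 * p) / 2 by omega] at this
    rcases lt_or_ge j q with hjq | hjq
    · have hiq : i < q := by omega
      simp only [hjq, hiq, if_true]
      exact hφ i (by simp [hi, hiq]) j (by simp [hj, hjq]) hij
    · beta_reduce
      rw [if_neg (by omega : ¬j < q)]
      refine ⟨?_, ?_, fun _ => by omega, hx hjq⟩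
      all_goals
        split_ifs with hiq
        · have h1 : φ i ≤ (T.filter (· < q)).sup φ := Finset.le_sup (by simp [hi, hiq])
          have := hgap i hi hiq
          omega
        · omega

/-- If a run meets more than m letters, then it consists of exactly 2m pins, is all of T and starts
with a right pin. The letter of this first pin is irrelevant, since no pin precedes it, so a window
of m letters still suffices. -/
theorem exists_movesPins {y x : ℕ → Bool} {m : ℕ}
    (hw : ∀ K P, ∃ p ≥ K, ∀ r < m, x (p + r) = y (P + r)) (T : Finset ℕ)
    (hT : T.card ≤ 2 * m) : ∃ φ, MovesPins y x T φ := by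
  by_cases h : ∀ q M, q ≤ M → (∀ k, q ≤ k → k ≤ M → k ∈ T) → M / 2 < q / 2 + m
  · exact exists_movesPins_of_runs hw T h
  push Not at h
  obtain ⟨q, M, h1, h2, h3⟩ := h
  have hsub : Finset.Icc q M ⊆ T := fun k hk => by
    rw [Finset.mem_Icc] at hk
    exact h2 k hk.1 hk.2
  have hcard := Finset.card_le_card hsub
  rw [Nat.card_Icc] at hcard
  obtain rfl : Finset.Icc q M = T :=
    Finset.eq_of_subset_of_card_le hsub (by rw [Nat.card_Icc]; omega)
  obtain ⟨p, hp, hpw⟩ := hw 1 ((q + 1) / 2)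
  -- Here q is odd, so the shift is even; p ≥ 1 keeps the subtraction from truncating.
  refine ⟨fun k => k + 2 * p - (q + 1), fun i hi j hj hij => ?_⟩
  rw [Finset.mem_Icc] at hi hj
  beta_reduce
  refine ⟨by omega, by omega, fun _ => by omega, ?_⟩
  have := hpw (j / 2 - (q + 1) / 2) (by omega)
  rwa [show (q + 1) / 2 + (j / 2 - (q + 1) / 2) = j / 2 by omega,
    show p + (j / 2 - (q + 1) / 2) = (j + 2 * p - (q + 1)) / 2 by omega] at this

theorem exists_embedsVia_of_windows {y x : ℕ → Bool} {m n : ℕ}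
    (hw : ∀ K P, ∃ p ≥ K, ∀ r < m, x (p + r) = y (P + r)) (hn : n ≤ 2 * m)
    {π : Equiv.Perm (Fin n)} (h : ∃ g, EmbedsVia y π g) : ∃ g, EmbedsVia x π g := by
  obtain ⟨g, hg⟩ := h
  obtain ⟨φ, hφ⟩ := exists_movesPins hw (Finset.univ.image g)
    (Finset.card_image_le.trans (by simpa using hn))
  exact ⟨_, hφ.embedsVia hg⟩

/-! ### A permutation that determines a factor of the binary word -/

/-- The positions of two initial pins and of a later run of pins that starts with the right pin
`2 * p + 1`. -/
def markedPins (p k : ℕ) : ℕ := if k < 2 then k else 2 * p - 1 + k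

theorem markedPins_strictMono (p : ℕ) : StrictMono (markedPins p) := by
  intro i j h
  simp only [markedPins]
  split_ifs <;> omega

theorem markedPins_adjacent {p : ℕ} (hp : 2 ≤ p) {i j : ℕ} (h : i < j) (c : ℕ) (hc : c < 2) :
    (markedPins p i + 1 = markedPins p j ∧ markedPins p j % 2 = c ∧ 2 ≤ j) ↔
      (i + 1 = j ∧ j % 2 = 1 - c ∧ 3 ≤ j) := by
  obtain rfl | rfl : c = 0 ∨ c = 1 := by omega
  all_goals
    simp only [markedPins]
    split_ifs <;> omega

/-- Here A and B say that a right pin comes directly after the image of the initial pin 0 or 1. Both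
cannot hold, so the two comparisons reveal its letter. -/
theorem iff_of_iff_not_iff {Y E A B : Prop} (hA : (Y ↔ ¬A) ↔ E) (hB : (Y ↔ ¬B) ↔ E)
    (hAB : ¬(A ∧ B)) : (Y ↔ E) ∧ ¬A ∧ ¬B := by
  by_cases A <;> by_cases B <;> by_cases Y <;> by_cases E <;> simp_all

/-- A map `f` of `{0, …, n}` into the pins of `y` that preserves the relative positions of the
marked pins is a translation on `{2, …, n}`, and respects the letters there. Here the letter `ε j`
belongs to the pin `j`. -/
theorem markedPins_rigid {y : ℕ → Bool} {n : ℕ} (hn : 5 ≤ n) (hodd : n % 2 = 1) (f : ℕ → ℕ) (ε : ℕ → Bool)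
    (hinj : ∀ i j, i < j → j ≤ n → f i ≠ f j)
    (hX : ∀ i j, i < j → j ≤ n → ((infinitePin y (f i)).1 < (infinitePin y (f j)).1 ↔
      ¬(i + 1 = j ∧ j % 2 = 1 ∧ 3 ≤ j)))
    (hY : ∀ i j, i < j → 2 ≤ j → j ≤ n → ((infinitePin y (f i)).2 < (infinitePin y (f j)).2 ↔
      (ε j = true ↔ ¬(i + 1 = j ∧ j % 2 = 0 ∧ 3 ≤ j)))) :
    f 2 % 2 = 1 ∧ ∀ j, 2 ≤ j → j ≤ n → f j = f 2 + (j - 2) ∧ y (f j / 2) = ε j := by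
  have cX : ∀ i j, i < j → j ≤ n → f i < f j →
      ((f i + 1 = f j ∧ f j % 2 = 0) ↔ (i + 1 = j ∧ j % 2 = 1 ∧ 3 ≤ j)) := by
    intro i j h1 h2 h3
    rw [← not_iff_not, ← hX i j h1 h2, pinX_lt_iff y h3]
  have cX' : ∀ i j, i < j → j ≤ n → f j < f i →
      ((f j + 1 = f i ∧ f i % 2 = 0) ↔ ¬(i + 1 = j ∧ j % 2 = 1 ∧ 3 ≤ j)) := by
    intro i j h1 h2 h3
    rw [← hX i j h1 h2, ← not_iff_not, ← pinX_lt_iff y h3, not_lt,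
      (pinX_ne y h3).le_iff_lt]
  have cY : ∀ i j, i < j → 2 ≤ j → j ≤ n → f i < f j →
      ((y (f j / 2) = true ↔ ¬(f i + 1 = f j ∧ f j % 2 = 1)) ↔
        (ε j = true ↔ ¬(i + 1 = j ∧ j % 2 = 0 ∧ 3 ≤ j))) := by
    intro i j h1 h2 h3 h4
    rw [← hY i j h1 h2 h3, (pinY_lt_iff y h4).1]
  have hne : ∀ i j, i ≤ n → j ≤ n → i ≠ j → f i ≠ f j := by
    intro i j h1 h2 h3
    rcases lt_or_gt_of_ne h3 with h | h
    · exact hinj i j h h2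
    · exact (hinj j i h h1).symm
  -- a right pin that is the last one comes right after the preceding pin
  have hright : ∀ j, 3 ≤ j → j ≤ n → j % 2 = 0 → (∀ i < j, f i < f j) →
      f (j - 1) + 1 = f j ∧ f j % 2 = 1 := by
    intro j h1 h2 h3 h4
    have a0 := cY 0 j (by omega) (by omega) h2 (h4 _ (by omega))
    have a1 := cY 1 j (by omega) (by omega) h2 (h4 _ (by omega))
    have a2 := cY (j - 1) j (by omega) (by omega) h2 (h4 _ (by omega))
    have n01 := hne 0 1 (by omega) (by omega) (by omega)
    rw [iff_true_right (by omega : ¬(0 + 1 = j ∧ j % 2 = 0 ∧ 3 ≤ j))] at a0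
    rw [iff_true_right (by omega : ¬(1 + 1 = j ∧ j % 2 = 0 ∧ 3 ≤ j))] at a1
    have h := (iff_of_iff_not_iff a0 a1 (by omega)).1
    have e : j - 1 + 1 = j ∧ j % 2 = 0 ∧ 3 ≤ j := by omega
    by_contra hcon
    rw [iff_true_right hcon, h] at a2
    by_cases hε : ε j = true
    · exact (a2.1 hε).1 hε e
    · exact hε (a2.2 ⟨fun h' => absurd h' hε, fun h' => absurd e h'⟩)
  have htop : ∀ i < n, f i < f n := by
    -- Let k have the largest image. If k ≠ n, two different pins are forced onto the same place.
    obtain ⟨k, hk, hmax⟩ := Finset.exists_max_image (Finset.range (n + 1)) f ⟨0, by simp⟩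
    rw [Finset.mem_range] at hk
    have hlt : ∀ i ≤ n, i ≠ k → f i < f k := fun i hi hik =>
      lt_of_le_of_ne (hmax i (by simp; omega)) (hne i k hi (by omega) hik)
    by_cases hkn : k = n
    · subst hkn
      exact fun i hi => hlt i (by omega) (by omega)
    exfalso
    have b0 := cX' k n (by omega) le_rfl (hlt n le_rfl (by omega))
    by_cases hk1 : k + 1 = n
    -- The images of n and n - 3 would both come directly before that of n - 2; n ≥ 5 makes n - 3
    -- and n - 2 an adjacent pair of the run.
    · obtain rfl : k = n - 1 := by omega
      obtain ⟨c1, c2⟩ := hright (n - 1) (by omega) (by omega) (by omega)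
        fun i hi => hlt i (by omega) (by omega)
      have n1 := hne n (n - 2) (by omega) (by omega) (by omega)
      have n2 := hne (n - 3) (n - 2) (by omega) (by omega) (by omega)
      have n3 := hne (n - 3) n (by omega) (by omega) (by omega)
      have l1 := hlt n le_rfl (by omega)
      have l2 := hlt (n - 3) (by omega) (by omega)
      rw [show n - 1 - 1 = n - 2 by omega] at c1
      have d1 := cX' (n - 2) n (by omega) le_rfl (by omega)
      have d2 := cX (n - 3) (n - 2) (by omega) (by omega) (by omega)
      omega
    -- The images of n and n - 1 would both come directly before that of k.
    · have l1 := hlt (n - 1) (by omega) (by omega)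
      have d1 := cX' k (n - 1) (by omega) (by omega) l1
      have n1 := hne n (n - 1) (by omega) (by omega) (by omega)
      omega
  have hstep : ∀ j, 3 ≤ j → j ≤ n → (∀ i < j, f i < f j) →
      f (j - 1) + 1 = f j ∧ f j % 2 = (j + 1) % 2 := by
    intro j h1 h2 h3
    rcases Nat.mod_two_eq_zero_or_one j with h | h
    · have := hright j h1 h2 h h3
      omega
    · have := cX (j - 1) j (by omega) h2 (h3 _ (by omega))
      omega
  -- Descending induction: the predecessor of the largest image sits directly before it, hence is
  -- largest among the remaining ones.
  have hall : ∀ d, 2 ≤ n - d → ∀ i < n - d, f i < f (n - d) := by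
    intro d
    induction d with
    | zero => exact fun _ => htop
    | succ d ih =>
      intro h i hi
      have h1 := ih (by omega)
      have h2 := (hstep (n - d) (by omega) (by omega) h1).1
      rw [show n - d - 1 = n - (d + 1) by omega] at h2
      have h3 := h1 i (by omega)
      have h4 := hne i (n - (d + 1)) (by omega) (by omega) (by omega)
      omega
  have hlast : ∀ j, 2 ≤ j → j ≤ n → ∀ i < j, f i < f j := by
    intro j h1 h2
    have := hall (n - j) (by omega)
    rwa [show n - (n - j) = j by omega] at this
  have hshift : ∀ d, d + 2 ≤ n → f (d + 2) = f 2 + d := by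
    intro d
    induction d with
    | zero => simp
    | succ d ih =>
      intro h
      have h1 := (hstep (d + 1 + 2) (by omega) h (hlast _ (by omega) h)).1
      have h2 := ih (by omega)
      rw [show d + 1 + 2 - 1 = d + 2 by omega] at h1
      omega
  have h3 := hstep 3 le_rfl (by omega) (hlast 3 (by omega) (by omega))
  have hf2 : f 2 % 2 = 1 := by
    have : f 3 = f 2 + 1 := hshift 1 (by omega)
    omega
  refine ⟨hf2, fun j h1 h2 => ⟨?_, ?_⟩⟩
  · have := hshift (j - 2) (by omega)
    rwa [show j - 2 + 2 = j by omega] at this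
  · have a0 := cY 0 j (by omega) h1 h2 (hlast j h1 h2 0 (by omega))
    have a1 := cY 1 j (by omega) h1 h2 (hlast j h1 h2 1 (by omega))
    have n01 := hne 0 1 (by omega) (by omega) (by omega)
    rw [iff_true_right (by omega : ¬(0 + 1 = j ∧ j % 2 = 0 ∧ 3 ≤ j))] at a0
    rw [iff_true_right (by omega : ¬(1 + 1 = j ∧ j % 2 = 0 ∧ 3 ≤ j))] at a1
    rw [Bool.eq_iff_iff]
    exact (iff_of_iff_not_iff a0 a1 (by omega)).1

/-- If a late window of length `m ≥ 3` of `x` does not occur in `y`, then some permutation of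
length `2 * m` embeds into the pin sequence of `x`, but not into that of `y`. -/
theorem exists_embedsVia_not {x y : ℕ → Bool} {m p : ℕ} (hm : 3 ≤ m) (hp : 2 ≤ p)
    (hnew : ∀ P, ∃ j < m, x (p + j) ≠ y (P + j)) :
    ∃ π : Equiv.Perm (Fin (2 * m)), (∃ g, EmbedsVia x π g) ∧ ¬∃ g, EmbedsVia y π g := by
  have hmono := markedPins_strictMono p
  obtain ⟨e, he1, he2⟩ := orderPerm_isOrderIsoTo
    (q := fun k : Fin (2 * m) => infinitePin x (markedPins p k))
    (fun a b h => Fin.ext (hmono.injective (pinX_injective x h)))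
    (fun a b h => Fin.ext (hmono.injective (pinY_injective x h)))
  refine ⟨_, ⟨fun a => markedPins p (e a), he1, he2⟩, ?_⟩
  rintro ⟨g, hg1, hg2⟩
  obtain ⟨f, hf⟩ : ∃ f : ℕ → ℕ, ∀ k (h : k < 2 * m), f k = g (e.symm ⟨k, h⟩) :=
    ⟨fun k => if h : k < 2 * m then g (e.symm ⟨k, h⟩) else 0, fun k h => dif_pos h⟩
  have hfX : ∀ i j, i < 2 * m → j < 2 * m →
      ((infinitePin y (f i)).1 < (infinitePin y (f j)).1 ↔
        (infinitePin x (markedPins p i)).1 < (infinitePin x (markedPins p j)).1) := by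
    intro i j hi hj
    rw [hf i hi, hf j hj]
    refine hg1.lt_iff_lt.trans (he1.lt_iff_lt.symm.trans ?_)
    simp
  have hfY : ∀ i j, i < 2 * m → j < 2 * m →
      ((infinitePin y (f i)).2 < (infinitePin y (f j)).2 ↔
        (infinitePin x (markedPins p i)).2 < (infinitePin x (markedPins p j)).2) := by
    intro i j hi hj
    rw [hf i hi, hf j hj, ← hg2, he2]
    simp
  have hinj : ∀ i j, i < j → j ≤ 2 * m - 1 → f i ≠ f j := by
    intro i j hij hj h
    rw [hf i (by omega), hf j (by omega)] at h
    have := e.symm.injective (hg1.injective (congrArg (fun k => (infinitePin y k).1) h))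
    rw [Fin.mk.injEq] at this
    omega
  have hX : ∀ i j, i < j → j ≤ 2 * m - 1 →
      ((infinitePin y (f i)).1 < (infinitePin y (f j)).1 ↔
        ¬(i + 1 = j ∧ j % 2 = 1 ∧ 3 ≤ j)) := by
    intro i j hij hj
    rw [hfX i j (by omega) (by omega), pinX_lt_iff x (hmono hij), not_iff_not]
    have := markedPins_adjacent hp hij 0 (by omega)
    simp only [markedPins] at this ⊢
    split_ifs at this ⊢ <;> omega
  have hY : ∀ i j, i < j → 2 ≤ j → j ≤ 2 * m - 1 →
      ((infinitePin y (f i)).2 < (infinitePin y (f j)).2 ↔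
        (x (markedPins p j / 2) = true ↔ ¬(i + 1 = j ∧ j % 2 = 0 ∧ 3 ≤ j))) := by
    intro i j hij h2 hj
    rw [hfY i j (by omega) (by omega), (pinY_lt_iff x (hmono hij)).1]
    have := markedPins_adjacent hp hij 1 (by omega)
    rw [and_iff_left h2] at this
    simp only [Nat.sub_self] at this
    rw [← this]
  obtain ⟨h2, hall⟩ := markedPins_rigid (by omega) (by omega) f
    (fun j => x (markedPins p j / 2)) hinj hX hY
  obtain ⟨d, hd, hne⟩ := hnew (f 2 / 2)
  apply hne
  -- The first letter of the window is read from the right pin 2, each later letter d from the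
  -- vertical pin 2d + 1.
  rcases Nat.eq_zero_or_pos d with rfl | hd0
  · have := (hall 2 le_rfl (by omega)).2
    rw [markedPins, if_neg (by omega), show (2 * p - 1 + 2) / 2 = p by omega] at this
    simpa using this.symm
  · obtain ⟨h3, h4⟩ := hall (2 * d + 1) (by omega) (by omega)
    rw [h3, markedPins, if_neg (by omega), show (2 * p - 1 + (2 * d + 1)) / 2 = p + d by omega,
      show (f 2 + (2 * d + 1 - 2)) / 2 = f 2 / 2 + d by omega] at h4
    exact h4.symm

/-! ### The main theorem -/

theorem theorem8p1 (s t : ℕ → ℕ) (hs : ∀ k, 0 < s k) (ht : ∀ k, 0 < t k)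
    (hst : toLex s < toLex t) :
    (∃ N : ℕ, (⋃ n ≤ N, ofLength (pinClass t) n) ⊂ ⋃ n ≤ N, ofLength (pinClass s) n) ∧
      enumeration (pinClass s) ≠ enumeration (pinClass t) := by
  have hS := consOne_pos hs
  have hS' := consOne_pos ht
  obtain ⟨I, hI, hlt⟩ := hst
  -- With 1 prepended, the two sequences first differ at the positive index I + 1.
  obtain ⟨n, hn, hwin, q, -, hq⟩ := exists_window_length I hS hS'
    (fun i hi => by
      rcases i with _ | i
      · rfl
      · exact hI i hi) hlt
  have hsub : ∀ k ≤ 2 * (n + 2), ofLength (pinClass t) k ⊆ ofLength (pinClass s) k := by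
    rintro k hk ⟨k', π⟩ ⟨hπ, rfl⟩
    refine ⟨?_, rfl⟩
    rw [mem_pinClass_iff ht] at hπ
    rw [mem_pinClass_iff hs]
    refine exists_embedsVia_of_windows (fun K P => ?_) hk hπ
    obtain ⟨p', h'⟩ := hwin P
    obtain ⟨p, hp, h⟩ := limitWord_recurrent hS K (n + 2) p'
    exact ⟨p, hp, fun r hr => (h r hr).trans (h' r hr)⟩
  -- A late occurrence of the new window keeps its pins away from the two initial ones.
  obtain ⟨p, hp, hpq⟩ := limitWord_recurrent hS 2 (n + 2) q
  obtain ⟨π, hπ, hπ'⟩ := exists_embedsVia_not (x := limitWord (consOne s))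
    (y := limitWord (consOne t)) (m := n + 2) (by omega) hp fun P => by
      obtain ⟨j, hj, hne⟩ := hq P
      exact ⟨j, hj, by rwa [hpq j hj]⟩
  rw [← mem_pinClass_iff hs] at hπ
  rw [← mem_pinClass_iff ht] at hπ'
  have hfin : (ofLength (pinClass s) (2 * (n + 2))).Finite :=
    (Set.finite_range fun σ : Equiv.Perm (Fin (2 * (n + 2))) => (⟨_, σ⟩ : FinPerm)).subset
      (by rintro ⟨k, σ⟩ ⟨-, rfl⟩; exact ⟨σ, rfl⟩)
  refine ⟨⟨2 * (n + 2), ?_⟩, fun heq => ?_⟩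
  · refine Set.ssubset_iff_exists.2 ⟨Set.iUnion₂_mono hsub, ⟨_, π⟩,
      Set.mem_iUnion₂.2 ⟨_, le_rfl, hπ, rfl⟩, fun hmem => ?_⟩
    obtain ⟨k, -, hk, -⟩ := Set.mem_iUnion₂.1 hmem
    exact hπ' hk
  · have := Set.ncard_lt_ncard
      (Set.ssubset_iff_exists.2 ⟨hsub _ le_rfl, ⟨_, π⟩, ⟨hπ, rfl⟩, fun h => hπ' h.1⟩) hfin
    exact this.ne (congrFun heq _).symm
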